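/- Let $n=m+s$. Consider the following functions of $q\in\mathbb R^n$: symmetric $M(q)>0$, $\mathbf M_d(q)>0$; $G(q)\in\mathbb R^{n\times m}$ of rank $m$; $G^\perp(q)\in\mathbb R^{s\times n}$ of rank $s$ with $G^\perp G=0$; $K_p(q)\ge 0$ ($m\times m$); a potential $V_d(q)\in\mathbb R$; and a skew-symmetric matrix $\mathbf J_2(q,\mathbf p)$, $(q,\mathbf p)\in\mathbb R^n\times\mathbb R^n$. Let $\mathbf M_d,G,G^\perp,V_d$ be $C^2$ and $M,\mathbf J_2,K_p$ be $C^1$. Assume that $\mathbf H_d(q,\mathbf p)=\frac12\mathbf p^\top\mathbf M_d^{-1}(q)\mathbf p+V_d(q)$ has a strict (local) minimum at $(q^\star,0)$. Put $$T=\begin{bmatrix}(G^\top G)^{-1}G^\top\\ G^\perp\end{bmatrix},\quad M_d=T\mathbf M_dT^\top,\quad \mathcal H_d(q,p_1,p_2)=\tfrac12p^\top M_d^{-1}(q)p+V_d(q),\quad p=\operatorname{col}(p_1,p_2),\ p_1\in\mathbb R^m,\ p_2\in\mathbb R^s,$$ $$J_p=\mathbf M_dM^{-1}\Big(\frac{\partial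 (T^{-1}p)}{\partial q}\Big)^{\!\top}-\frac{\partial (T^{-1}p)}{\partial q}M^{-1}\mathbf M_d+\mathbf J_2(q,T^{-1}p),$$ where $\partial(T^{-1}p)/\partial q$ is the Jacobian (entry $(i,j)$ is $\partial (T^{-1}p)_i/\partial q_j$), and $$S_1=M^{-1}\mathbf M_dG(G^\top G)^{-1},\quad S_2=M^{-1}\mathbf M_dG^{\perp\top},\quad S_{31}=(G^\top G)^{-1}G^\top J_pG(G^\top G)^{-1},$$ $$S_{32}=(G^\top G)^{-1}G^\top J_pG^{\perp\top},\quad S_{34}=G^\perp J_pG^{\perp\top}.$$ The mechanical system with input $u\in\mathbb R^m$ and an unknown constant matched disturbance $d\in\mathbb R^m$ is $$\dot q=S_1\nabla_{p_1}\mathcal H_d+S_2\nabla_{p_2}\mathcal H_d,\qquad \dot p_1=-S_1^\top\nabla_q\mathcal H_d+(S_{31}-K_p)\nabla_{p_1}\mathcal H_d+S_{32}\nabla_{p_2}\mathcal H_d+u-d,$$ $$\dot p_2=-S_2^\top\nabla_q\mathcal H_d-S_{32}^\top\nabla_{p_1}\mathcal H_d+S_{34}\nabla_{p_2}\mathcal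 H_d.$$ Let $K_I,R_{c_1},R_{c_2}$ be constant symmetric positive definite and $J_{c_1}$ constant skew-symmetric $m\times m$ matrices, $\mathcal H_c(p_1,\zeta)=\frac12(p_1-\zeta)^\top K_I(p_1-\zeta)$, and close the loop with the controller (state $\zeta\in\mathbb R^m$) $$u=(-S_{31}+K_p+J_{c_1}-R_{c_1}-R_{c_2})\nabla_{p_1}\mathcal H_d+(J_{c_1}-R_{c_1})\nabla_{p_1}\mathcal H_c,\qquad \dot\zeta=-R_{c_2}\nabla_{p_1}\mathcal H_d-S_1^\top\nabla_q\mathcal H_d+S_{32}\nabla_{p_2}\mathcal H_d.$$ Then, for every $d\in\mathbb R^m$, the point $x^\star=(q^\star,0,0,\zeta^\star)$ with $\zeta^\star=-K_I^{-1}(J_{c_1}-R_{c_1})^{-1}d$ is an equilibrium of the closed loop in the state $x=(q,p_1,p_2,\zeta)$, and the following hold. (i) $x^\star$ is Lyapunov stable (solutions starting near $x^\star$ exist for all $t\ge0$ and stay near $x^\star$). With $z=p_1-\zeta$, $z^\star=-\zeta^\star$, the function $\mathcal W=\mathcal H_d+\frac12(z-z^\star)^\top K_I(z-z^\star)$ is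 a Lyapunov function: it is differentiable, has a strict (local) minimum at $x^\star$, and satisfies $\dot{\mathcal W}\le0$ along the closed-loop vector field at every state. (ii) If the output $y_{p_1}=\operatorname{col}\big(\nabla_{p_1}\mathcal H_d,\ \nabla_{p_1}\mathcal H_c-(J_{c_1}-R_{c_1})^{-1}d\big)$ is detectable, or only locally detectable, then $x^\star$ is asymptotically stable. Here detectable means that every closed-loop solution on $[0,\infty)$ with $y_{p_1}\equiv0$ converges to $x^\star$; locally detectable means that this holds for the solutions that remain in some neighbourhood of $x^\star$. (iii) If $V_d$ is radially unbounded ($V_d(q)\to\infty$ as $|q|\to\infty$), these properties are global: $x^\star$ is globally stable (stable, solutions from all initial states exist for all $t\ge0$, and solutions are bounded uniformly over bounded sets of initial states), and if $y_{p_1}$ is detectable, then $x^\star$ is globally asymptotically stable (globally stable, and every solution on $[0,\infty)$ converges to $x^\star$). -/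

import Mathlib

open Set Filter Topology
open scoped Matrix

noncomputable section

namespace IntegralAction

/-! ### Gradients and Jacobians in coordinates

`ℝᵏ` is represented by the coordinate space `ι → ℝ`. The notions below (derivatives, stability,
boundedness, properness) only depend on its topological vector space structure, not on the norm. -/

/-- The gradient of a scalar function: the column of its partial derivatives. -/
def grad {ι : Type*} [Fintype ι] [DecidableEq ι] (h : (ι → ℝ) → ℝ) (x : ι → ℝ) : ι → ℝ :=
  fun i => fderiv ℝ h x (Pi.single i 1)

/-- The Jacobian `∂g/∂x`: row `i`, column `j` is `∂gᵢ/∂xⱼ`. -/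
def jacobian {ι κ : Type*} [Fintype ι] [DecidableEq ι] [Fintype κ]
    (g : (ι → ℝ) → (κ → ℝ)) (x : ι → ℝ) : Matrix κ ι ℝ :=
  Matrix.of fun i j => fderiv ℝ g x (Pi.single j 1) i

/-- `xs` is a strict (local) minimum of `h`. -/
def IsStrictMin {E : Type*} [TopologicalSpace E] (h : E → ℝ) (xs : E) : Prop :=
  ∀ᶠ x in 𝓝[≠] xs, h xs < h x

/-! ### Stability notions for an autonomous system `ẋ = f x` -/

section Stability

variable {E : Type*} [NormedAddCommGroup E] [NormedSpace ℝ E]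

/-- `x` solves `ẋ = f x` on the time interval `I`. -/
def IsSolutionOn (f : E → E) (x : ℝ → E) (I : Set ℝ) : Prop :=
  IsIntegralCurveOn x (fun _ => f) I

/-- Some solution starting at `x₀` exists for all `t ≥ 0`. -/
def HasForwardSolution (f : E → E) (x₀ : E) : Prop :=
  ∃ x : ℝ → E, x 0 = x₀ ∧ IsSolutionOn f x (Ici 0)

/-- Lyapunov stability: solutions starting close enough to `xs` exist for all future times, and
every solution starting there, on whatever interval `[0, τ]` it is defined, stays close. -/
def IsStable (f : E → E) (xs : E) : Prop :=
  ∀ ε > 0, ∃ δ > 0, ∀ x₀ : E, dist x₀ xs < δ →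
    HasForwardSolution f x₀ ∧
    ∀ (τ : ℝ) (x : ℝ → E), x 0 = x₀ → IsSolutionOn f x (Icc 0 τ) →
      ∀ t ∈ Icc 0 τ, dist (x t) xs < ε

/-- Asymptotic stability: stable and locally attractive. -/
def IsAsymptoticallyStable (f : E → E) (xs : E) : Prop :=
  IsStable f xs ∧
  ∃ δ > 0, ∀ x : ℝ → E, dist (x 0) xs < δ → IsSolutionOn f x (Ici 0) →
    Tendsto x atTop (𝓝 xs)

/-- Global stability: stable, every initial state has a solution for all future times, and
solutions are bounded, uniformly over bounded sets of initial states. -/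
def IsGloballyStable (f : E → E) (xs : E) : Prop :=
  IsStable f xs ∧
  (∀ x₀ : E, HasForwardSolution f x₀) ∧
  ∀ r > 0, ∃ R > 0, ∀ (τ : ℝ) (x : ℝ → E), dist (x 0) xs < r → IsSolutionOn f x (Icc 0 τ) →
    ∀ t ∈ Icc 0 τ, dist (x t) xs < R

/-- Global asymptotic stability: globally stable and every solution converges to `xs`. -/
def IsGloballyAsymptoticallyStable (f : E → E) (xs : E) : Prop :=
  IsGloballyStable f xs ∧
  ∀ x : ℝ → E, IsSolutionOn f x (Ici 0) → Tendsto x atTop (𝓝 xs)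

/-- The output `y = h x` of `ẋ = f x` is detectable (with respect to `xs`) on the set `U`: every
solution on `[0, ∞)` that stays in `U` and has identically zero output converges to `xs`.
For `U = univ` this is (zero-state) detectability, for `U` a neighbourhood of `xs` its local
version. -/
def IsDetectableOn {Y : Type*} [Zero Y] (f : E → E) (h : E → Y) (xs : E) (U : Set E) : Prop :=
  ∀ x : ℝ → E, IsSolutionOn f x (Ici 0) → (∀ t, 0 ≤ t → x t ∈ U) → (∀ t, 0 ≤ t → h (x t) = 0) →
    Tendsto x atTop (𝓝 xs)

/-- `W` is a (weak) Lyapunov function for the equilibrium `xs` of `ẋ = f x`. -/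
def IsLyapunovFunction (f : E → E) (W : E → ℝ) (xs : E) : Prop :=
  Differentiable ℝ W ∧ IsStrictMin W xs ∧ ∀ x, fderiv ℝ W x (f x) ≤ 0

end Stability

/-! ### The mechanical system -/

/-- Coordinates of the configuration space `ℝⁿ`, `n = m + s`. -/
abbrev Idx (m s : ℕ) : Type := Fin m ⊕ Fin s

/-- Data of a mechanical system with `n = m + s` degrees of freedom and `m` inputs that has been
shaped by interconnection and damping assignment. -/
structure MechSystem (m s : ℕ) where
  /-- open-loop mass matrix -/
  M : (Idx m s → ℝ) → Matrix (Idx m s) (Idx m s) ℝ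
  /-- shaped mass matrix, in the original momenta -/
  Md : (Idx m s → ℝ) → Matrix (Idx m s) (Idx m s) ℝ
  /-- interconnection matrix, a function of configuration and original momentum -/
  J2 : (Idx m s → ℝ) → (Idx m s → ℝ) → Matrix (Idx m s) (Idx m s) ℝ
  /-- input matrix -/
  G : (Idx m s → ℝ) → Matrix (Idx m s) (Fin m) ℝ
  /-- full-rank left annihilator of the input matrix -/
  Gperp : (Idx m s → ℝ) → Matrix (Fin s) (Idx m s) ℝ
  /-- damping gain -/
  Kp : (Idx m s → ℝ) → Matrix (Fin m) (Fin m) ℝ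
  /-- shaped potential energy -/
  Vd : (Idx m s → ℝ) → ℝ
  M_posDef : ∀ q, (M q).PosDef
  Md_posDef : ∀ q, (Md q).PosDef
  J2_skew : ∀ q pb, (J2 q pb)ᵀ = -J2 q pb
  G_rank : ∀ q, (G q).rank = m
  Gperp_rank : ∀ q, (Gperp q).rank = s
  Gperp_mul_G : ∀ q, Gperp q * G q = 0
  Kp_posSemidef : ∀ q, (Kp q).PosSemidef
  M_smooth : ∀ i j, ContDiff ℝ 1 fun q => M q i j
  Md_smooth : ∀ i j, ContDiff ℝ 2 fun q => Md q i j
  J2_smooth : ∀ i j, ContDiff ℝ 1 fun x : (Idx m s → ℝ) × (Idx m s → ℝ) => J2 x.1 x.2 i j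
  G_smooth : ∀ i j, ContDiff ℝ 2 fun q => G q i j
  Gperp_smooth : ∀ i j, ContDiff ℝ 2 fun q => Gperp q i j
  Kp_smooth : ∀ i j, ContDiff ℝ 1 fun q => Kp q i j
  Vd_smooth : ContDiff ℝ 2 Vd

namespace MechSystem

variable {m s : ℕ} (P : MechSystem m s)

/-- The Hamiltonian in the original coordinates `(q, pb)`:
`½ pbᵀ Md(q)⁻¹ pb + Vd(q)`. -/
def Hbold (q pb : Idx m s → ℝ) : ℝ :=
  1 / 2 * (pb ⬝ᵥ (P.Md q)⁻¹ *ᵥ pb) + P.Vd q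

/-- `(GᵀG)⁻¹Gᵀ`. -/
def Gplus (q : Idx m s → ℝ) : Matrix (Fin m) (Idx m s) ℝ :=
  ((P.G q)ᵀ * P.G q)⁻¹ * (P.G q)ᵀ

/-- The matrix of the momentum transformation `p = T(q) pb`, the rows of `(GᵀG)⁻¹Gᵀ` above
those of the annihilator. -/
def T (q : Idx m s → ℝ) : Matrix (Idx m s) (Idx m s) ℝ :=
  Matrix.fromRows (P.Gplus q) (P.Gperp q)

/-- The shaped mass matrix `T Md Tᵀ` in the new momenta. -/
def MdT (q : Idx m s → ℝ) : Matrix (Idx m s) (Idx m s) ℝ :=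
  P.T q * P.Md q * (P.T q)ᵀ

/-- The Hamiltonian in the new coordinates, `½ pᵀ (T Md Tᵀ)⁻¹ p + Vd(q)`, `p = col(p₁, p₂)`. -/
def Hd (q : Idx m s → ℝ) (p₁ : Fin m → ℝ) (p₂ : Fin s → ℝ) : ℝ :=
  1 / 2 * (Sum.elim p₁ p₂ ⬝ᵥ (P.MdT q)⁻¹ *ᵥ Sum.elim p₁ p₂) + P.Vd q

/-- `∇_q H_d`. -/
def gradq (q : Idx m s → ℝ) (p₁ : Fin m → ℝ) (p₂ : Fin s → ℝ) : Idx m s → ℝ :=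
  grad (fun q' => P.Hd q' p₁ p₂) q

/-- `∇_{p₁} H_d`. -/
def gradp₁ (q : Idx m s → ℝ) (p₁ : Fin m → ℝ) (p₂ : Fin s → ℝ) : Fin m → ℝ :=
  grad (fun p₁' => P.Hd q p₁' p₂) p₁

/-- `∇_{p₂} H_d`. -/
def gradp₂ (q : Idx m s → ℝ) (p₁ : Fin m → ℝ) (p₂ : Fin s → ℝ) : Fin s → ℝ :=
  grad (fun p₂' => P.Hd q p₁ p₂') p₂

/-- The Jacobian `∂(T(q)⁻¹ p)/∂q` for fixed `p`. -/
def jacTinv (q p : Idx m s → ℝ) : Matrix (Idx m s) (Idx m s) ℝ :=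
  jacobian (fun q' => (P.T q')⁻¹ *ᵥ p) q

/-- The skew-symmetric matrix `J_p`; with this orientation of the Jacobians the system below is
exactly the image of the system in `(q, pb)` under `p = T(q) pb`. -/
def Jp (q : Idx m s → ℝ) (p₁ : Fin m → ℝ) (p₂ : Fin s → ℝ) : Matrix (Idx m s) (Idx m s) ℝ :=
  P.Md q * (P.M q)⁻¹ * (P.jacTinv q (Sum.elim p₁ p₂))ᵀ
    - P.jacTinv q (Sum.elim p₁ p₂) * (P.M q)⁻¹ * P.Md q
    + P.J2 q ((P.T q)⁻¹ *ᵥ Sum.elim p₁ p₂)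

def S₁ (q : Idx m s → ℝ) : Matrix (Idx m s) (Fin m) ℝ :=
  (P.M q)⁻¹ * P.Md q * P.G q * ((P.G q)ᵀ * P.G q)⁻¹

def S₂ (q : Idx m s → ℝ) : Matrix (Idx m s) (Fin s) ℝ :=
  (P.M q)⁻¹ * P.Md q * (P.Gperp q)ᵀ

def S₃₁ (q : Idx m s → ℝ) (p₁ : Fin m → ℝ) (p₂ : Fin s → ℝ) : Matrix (Fin m) (Fin m) ℝ :=
  ((P.G q)ᵀ * P.G q)⁻¹ * (P.G q)ᵀ * P.Jp q p₁ p₂ * P.G q * ((P.G q)ᵀ * P.G q)⁻¹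

def S₃₂ (q : Idx m s → ℝ) (p₁ : Fin m → ℝ) (p₂ : Fin s → ℝ) : Matrix (Fin m) (Fin s) ℝ :=
  ((P.G q)ᵀ * P.G q)⁻¹ * (P.G q)ᵀ * P.Jp q p₁ p₂ * (P.Gperp q)ᵀ

def S₃₄ (q : Idx m s → ℝ) (p₁ : Fin m → ℝ) (p₂ : Fin s → ℝ) : Matrix (Fin s) (Fin s) ℝ :=
  P.Gperp q * P.Jp q p₁ p₂ * (P.Gperp q)ᵀ

/-- Right-hand side of the mechanical system in the coordinates `(q, p₁, p₂)` with input `u` and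
matched disturbance `d`. -/
def plant (u d : Fin m → ℝ) (q : Idx m s → ℝ) (p₁ : Fin m → ℝ) (p₂ : Fin s → ℝ) :
    (Idx m s → ℝ) × (Fin m → ℝ) × (Fin s → ℝ) :=
  ( P.S₁ q *ᵥ P.gradp₁ q p₁ p₂ + P.S₂ q *ᵥ P.gradp₂ q p₁ p₂,
    -((P.S₁ q)ᵀ *ᵥ P.gradq q p₁ p₂) + (P.S₃₁ q p₁ p₂ - P.Kp q) *ᵥ P.gradp₁ q p₁ p₂
      + P.S₃₂ q p₁ p₂ *ᵥ P.gradp₂ q p₁ p₂ + (u - d),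
    -((P.S₂ q)ᵀ *ᵥ P.gradq q p₁ p₂) - (P.S₃₂ q p₁ p₂)ᵀ *ᵥ P.gradp₁ q p₁ p₂
      + P.S₃₄ q p₁ p₂ *ᵥ P.gradp₂ q p₁ p₂ )

end MechSystem

/-! ### The integral-action controller and the closed loop -/

/-- The constant controller gains. -/
structure Gains (m : ℕ) where
  KI : Matrix (Fin m) (Fin m) ℝ
  Jc₁ : Matrix (Fin m) (Fin m) ℝ
  Rc₁ : Matrix (Fin m) (Fin m) ℝ
  Rc₂ : Matrix (Fin m) (Fin m) ℝ
  KI_posDef : KI.PosDef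
  Jc₁_skew : Jc₁ᵀ = -Jc₁
  Rc₁_posDef : Rc₁.PosDef
  Rc₂_posDef : Rc₂.PosDef

/-- `H_c = ½ (p₁ - ζ)ᵀ K_I (p₁ - ζ)`. -/
def Gains.Hc {m : ℕ} (K : Gains m) (p₁ ζ : Fin m → ℝ) : ℝ :=
  1 / 2 * ((p₁ - ζ) ⬝ᵥ K.KI *ᵥ (p₁ - ζ))

/-- `∇_{p₁} H_c`. -/
def Gains.gradHc {m : ℕ} (K : Gains m) (p₁ ζ : Fin m → ℝ) : Fin m → ℝ :=
  grad (fun p₁' => K.Hc p₁' ζ) p₁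

/-- Closed-loop states `(q, p₁, p₂, ζ)`. -/
abbrev State (m s : ℕ) : Type :=
  (Idx m s → ℝ) × (Fin m → ℝ) × (Fin s → ℝ) × (Fin m → ℝ)

section ClosedLoop

variable {m s : ℕ} (P : MechSystem m s) (K : Gains m)

/-- The control law `u`; it does not know the disturbance. -/
def control (q : Idx m s → ℝ) (p₁ : Fin m → ℝ) (p₂ : Fin s → ℝ) (ζ : Fin m → ℝ) : Fin m → ℝ :=
  (-P.S₃₁ q p₁ p₂ + P.Kp q + K.Jc₁ - K.Rc₁ - K.Rc₂) *ᵥ P.gradp₁ q p₁ p₂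
    + (K.Jc₁ - K.Rc₁) *ᵥ K.gradHc p₁ ζ

/-- The right-hand side of the controller dynamics `ζ̇ = …`. -/
def controllerField (q : Idx m s → ℝ) (p₁ : Fin m → ℝ) (p₂ : Fin s → ℝ) : Fin m → ℝ :=
  -(K.Rc₂ *ᵥ P.gradp₁ q p₁ p₂) - (P.S₁ q)ᵀ *ᵥ P.gradq q p₁ p₂
    + P.S₃₂ q p₁ p₂ *ᵥ P.gradp₂ q p₁ p₂

/-- The closed loop: the plant with disturbance `d`, driven by the controller. -/
def closedLoop (d : Fin m → ℝ) : State m s → State m s :=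
  fun (q, p₁, p₂, ζ) =>
    let v := P.plant (control P K q p₁ p₂ ζ) d q p₁ p₂
    (v.1, v.2.1, v.2.2, controllerField P K q p₁ p₂)

/-- The equilibrium `(q*, 0, -K_I⁻¹ (J_{c₁} - R_{c₁})⁻¹ d)`. -/
def equilibrium (qs : Idx m s → ℝ) (d : Fin m → ℝ) : State m s :=
  (qs, 0, 0, -(K.KI⁻¹ *ᵥ (K.Jc₁ - K.Rc₁)⁻¹ *ᵥ d))

/-- The output `y_{p₁} = col(∇_{p₁}H_d, ∇_{p₁}H_c - (J_{c₁} - R_{c₁})⁻¹ d)`. -/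
def output (d : Fin m → ℝ) : State m s → (Fin m → ℝ) × (Fin m → ℝ) :=
  fun (q, p₁, p₂, ζ) =>
    (P.gradp₁ q p₁ p₂, K.gradHc p₁ ζ - (K.Jc₁ - K.Rc₁)⁻¹ *ᵥ d)

/-- `W = H_d + ½ (z - z*)ᵀ K_I (z - z*)`, `z = p₁ - ζ`, `z* = K_I⁻¹ (J_{c₁} - R_{c₁})⁻¹ d`. -/
def lyapunov (d : Fin m → ℝ) : State m s → ℝ :=
  fun (q, p₁, p₂, ζ) =>
    let e := (p₁ - ζ) - K.KI⁻¹ *ᵥ (K.Jc₁ - K.Rc₁)⁻¹ *ᵥ d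
    P.Hd q p₁ p₂ + 1 / 2 * (e ⬝ᵥ K.KI *ᵥ e)

end ClosedLoop

end IntegralAction

end

namespace IntegralAction

/-! ### Lyapunov theory and the invariance principle for `C¹` autonomous systems. -/

section Dynamics

variable {E : Type*} [NormedAddCommGroup E] [NormedSpace ℝ E]

/-! Write g₁ for ∇_{p₁}H_d and e = K_I(z - z⋆). The controller makes ṗ₁ and ζ̇ differ by exactly
(J_{c₁} - R_{c₁})(g₁ + e), so ż has this form and the constant disturbance is absorbed by the shift
z⋆ (`closedLoop_apply`). The closed loop then acts on W like a port-Hamiltonian system: all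
interconnection terms cancel in pairs or by skew-symmetry, and Ẇ = -g₁ᵀR_{c₂}g₁ -
(g₁+e)ᵀR_{c₁}(g₁+e) (`fderiv_lyapunov_closedLoop`). Hence Ẇ ≤ 0, with equality only where g₁ = e =
0, that is, where the output vanishes.

W has a strict minimum at the equilibrium: V_d inherits one from the slice of zero momentum, and W
adds to it positive definite quadratic forms in p and z - z⋆. If V_d is proper, the sublevel sets of
W are bounded.

The rest is general theory. Stability comes from a barrier sphere around the minimum
(`IsStrictMin.trapping`), and convergence from a LaSalle argument (`tendsto_of_isDetectableOn`): W
is constant along the solution through an accumulation point, so its output is zero, detectability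
brings it to the equilibrium, and stability carries this over to the original solution. Forward
existence is obtained by cutting the field off outside a ball that solutions cannot leave. -/

theorem IsSolutionOn.congr_field {f g : E → E} {x : ℝ → E} {I : Set ℝ} (hx : IsSolutionOn f x I)
    (h : ∀ t ∈ I, f (x t) = g (x t)) : IsSolutionOn g x I := by
  intro t ht
  have : HasDerivWithinAt x (f (x t)) I t := hx t ht
  rwa [h t ht] at this

theorem IsSolutionOn.mono {f : E → E} {x : ℝ → E} {I J : Set ℝ} (hx : IsSolutionOn f x J)
    (h : I ⊆ J) : IsSolutionOn f x I :=
  IsIntegralCurveOn.mono hx h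

theorem IsSolutionOn.hasDerivWithinAt_comp {f : E → E} {W : E → ℝ} (hW : Differentiable ℝ W)
    {x : ℝ → E} {I : Set ℝ} (hx : IsSolutionOn f x I) {t : ℝ} (ht : t ∈ I) :
    HasDerivWithinAt (W ∘ x) (fderiv ℝ W (x t) (f (x t))) I t :=
  (hW (x t)).hasFDerivAt.comp_hasDerivWithinAt t (hx t ht)

theorem IsSolutionOn.antitoneOn {f : E → E} {W : E → ℝ} (hW : Differentiable ℝ W)
    (hf : ∀ x, fderiv ℝ W x (f x) ≤ 0) {x : ℝ → E} {I : Set ℝ} (hI : Convex ℝ I)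
    (hx : IsSolutionOn f x I) : AntitoneOn (W ∘ x) I :=
  antitoneOn_of_hasDerivWithinAt_nonpos hI
    (fun _ ht => (hx.hasDerivWithinAt_comp hW ht).continuousWithinAt)
    (fun _ ht => (hx.hasDerivWithinAt_comp hW (interior_subset ht)).mono interior_subset)
    (fun _ _ => hf _)

/-- Solutions of any field along which `W` decreases cannot escape from a strict minimum of `W`. -/
theorem IsStrictMin.trapping [FiniteDimensional ℝ E] {W : E → ℝ} {xs : E}
    (hW : Differentiable ℝ W) (hmin : IsStrictMin W xs) {ε : ℝ} (hε : 0 < ε) :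
    ∃ δ > 0, ∀ f : E → E, (∀ x, fderiv ℝ W x (f x) ≤ 0) → ∀ (τ : ℝ) (x : ℝ → E),
      dist (x 0) xs < δ → IsSolutionOn f x (Icc 0 τ) → ∀ t ∈ Icc 0 τ, dist (x t) xs < ε := by
  have : ProperSpace E := FiniteDimensional.proper_real E
  obtain ⟨r₀, hr₀, hball⟩ := Metric.eventually_nhds_iff.1 (eventually_nhdsWithin_iff.1 hmin)
  obtain ⟨r, hr, hrlt⟩ : ∃ r > 0, r < min r₀ ε := exists_between (lt_min hr₀ hε)
  -- The barrier level is the minimum of W on a small sphere. The sphere is empty when E is trivial,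
  -- and then any level above W(xs) serves.
  obtain ⟨c, hc, hcs⟩ : ∃ c, W xs < c ∧ ∀ y ∈ Metric.sphere xs r, c ≤ W y := by
    rcases (Metric.sphere xs r).eq_empty_or_nonempty with h | h
    · exact ⟨W xs + 1, by linarith, by simp [h]⟩
    · obtain ⟨y, hy, hmin⟩ :=
        (isCompact_sphere xs r).exists_isMinOn h hW.continuous.continuousOn
      refine ⟨W y, hball ?_ ?_, fun z hz => hmin hz⟩
      · rw [Metric.mem_sphere.1 hy]; exact hrlt.trans_le (min_le_left _ _)
      · exact Metric.ne_of_mem_sphere hy hr.ne'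
  obtain ⟨δ, hδ, hδc⟩ := Metric.eventually_nhds_iff.1
    (hW.continuous.continuousAt.eventually_lt_const hc)
  refine ⟨min δ r, lt_min hδ hr, fun f hf τ x hx0 hx t ht => ?_⟩
  by_contra! hge
  have hcont : ContinuousOn (fun t => dist (x t) xs) (Icc 0 t) :=
    
    (continuous_id.dist continuous_const).comp_continuousOn
      (IsIntegralCurveOn.continuousOn (hx.mono (Icc_subset_Icc_right ht.2)))
  obtain ⟨u, hu, hur⟩ := intermediate_value_Icc ht.1 hcont
    (show r ∈ Icc (dist (x 0) xs) (dist (x t) xs) from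
      ⟨(hx0.trans_le (min_le_right _ _)).le, (hrlt.le.trans (min_le_right _ _)).trans hge⟩)
  have h1 := hx.antitoneOn hW hf (convex_Icc 0 τ) ⟨le_rfl, ht.1.trans ht.2⟩
    ⟨hu.1, hu.2.trans ht.2⟩ hu.1
  have h2 := hcs (x u) hur
  have h3 := hδc (hx0.trans_le (min_le_left _ _))
  simp only [Function.comp_apply] at h1
  linarith

theorem hasDerivWithinAt_Ici_of_Icc {x : ℝ → E} {x' : E} {a t : ℝ} (ht : t ∈ Ico 0 a)
    (h : HasDerivWithinAt x x' (Icc 0 a) t) : HasDerivWithinAt x x' (Ici t) t :=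
  h.mono_of_mem_nhdsWithin (mem_of_superset (Icc_mem_nhdsGE ht.2) (Icc_subset_Icc_left ht.1))

/-- The bound on the field makes Picard–Lindelöf work on [0, a] for every a: in time a a solution
travels at most L·a, so a ball of that radius suffices. Uniqueness glues these solutions. -/
theorem exists_solution_of_lipschitz_of_bounded [CompleteSpace E] {f : E → E} {K L : NNReal}
    (hf : LipschitzWith K f) (hL : ∀ x, ‖f x‖ ≤ L) (x₀ : E) : HasForwardSolution f x₀ := by
  have hloc : ∀ a : ℝ, 0 ≤ a → ∃ x : ℝ → E, x 0 = x₀ ∧ IsSolutionOn f x (Icc 0 a) := by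
    intro a ha
    have hpl : IsPicardLindelof (fun _ => f) (⟨0, le_rfl, ha⟩ : Icc 0 a) x₀ (L * ⟨a, ha⟩) 0 L K :=
      .of_time_independent (fun x _ => hL x) hf.lipschitzOnWith (by
        simp only [sub_zero, sub_self, NNReal.coe_zero, max_eq_left ha]
        exact le_rfl)
    exact hpl.exists_eq_forall_mem_Icc_hasDerivWithinAt₀
  choose! γ hγ0 hγ using hloc
  have huniq : ∀ a b, 0 ≤ a → a ≤ b → EqOn (γ a) (γ b) (Icc 0 a) := by
    intro a b ha hab
    have hb := (hγ b (ha.trans hab)).mono (Icc_subset_Icc_right hab)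
    exact ODE_solution_unique_of_mem_Icc_right (v := fun _ => f) (s := fun _ => univ)
      (fun _ _ => hf.lipschitzOnWith)
      (hγ a ha).continuousOn
      (fun t ht => hasDerivWithinAt_Ici_of_Icc ht (hγ a ha t (Ico_subset_Icc_self ht)))
      (fun _ _ => mem_univ _)
      hb.continuousOn
      (fun t ht => hasDerivWithinAt_Ici_of_Icc ht (hb t (Ico_subset_Icc_self ht)))
      (fun _ _ => mem_univ _) (by rw [hγ0 a ha, hγ0 b (ha.trans hab)])
  -- The extra unit of time keeps t away from the right end of [0, t + 1], so this interval is a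
  -- neighbourhood of t within [0, ∞).
  refine ⟨fun t => γ (t + 1) t, by simp [hγ0], fun t ht => ?_⟩
  have ht : (0 : ℝ) ≤ t := ht
  have heq : ∀ u ∈ Icc 0 (t + 1), γ (u + 1) u = γ (t + 1) u := by
    intro u hu
    rcases le_total u t with h | h
    · exact huniq (u + 1) (t + 1) (by linarith [hu.1]) (by linarith) ⟨hu.1, by linarith⟩
    · exact (huniq (t + 1) (u + 1) (by linarith) (by linarith) hu).symm
  have h := (hγ (t + 1) (by linarith) t ⟨ht, by linarith⟩)
  have h' : HasDerivWithinAt (fun u => γ (u + 1) u) (f (γ (t + 1) t)) (Icc 0 (t + 1)) t :=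
    h.congr heq (heq t ⟨ht, by linarith⟩)
  refine h'.mono_of_mem_nhdsWithin ?_
  rw [mem_nhdsWithin]
  exact ⟨Iio (t + 1), isOpen_Iio, by simp, fun u hu => ⟨hu.2, le_of_lt hu.1⟩⟩

/-- A `C¹` vector field agrees on any ball with a bounded Lipschitz one with the same orbits. -/
theorem exists_cutoff [FiniteDimensional ℝ E] {f : E → E} (hf : ContDiff ℝ 1 f) (xs : E) {R : ℝ}
    (hR : 0 < R) :
    ∃ (g : E → E) (K L : NNReal), LipschitzWith K g ∧ (∀ x, ‖g x‖ ≤ L) ∧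
      (∀ x, ∃ c : ℝ, 0 ≤ c ∧ g x = c • f x) ∧ ∀ x ∈ Metric.closedBall xs R, g x = f x := by
  let χ : ContDiffBump xs := ⟨R, R + 1, hR, by linarith⟩
  have hg : ContDiff ℝ 1 fun x => χ x • f x := χ.contDiff.smul hf
  have hcs : HasCompactSupport fun x => χ x • f x := χ.hasCompactSupport.smul_right
  obtain ⟨K, hK⟩ := hg.lipschitzWith_of_hasCompactSupport hcs one_ne_zero
  obtain ⟨L, hL⟩ := hcs.exists_bound_of_continuous hg.continuous
  refine ⟨fun x => χ x • f x, K, L.toNNReal, hK,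
    fun x => (hL x).trans (Real.le_coe_toNNReal L), fun x => ⟨χ x, χ.nonneg, rfl⟩, fun x hx => ?_⟩
  simp [χ.one_of_mem_closedBall hx]

/-- Lets the cut-off field of `exists_cutoff` inherit the dissipation inequality, so that trapping
and sublevel arguments apply to it before it is known to agree with f along the solution. -/
theorem fderiv_nonpos_of_nonneg_smul {f g : E → E} {W : E → ℝ}
    (hf : ∀ x, fderiv ℝ W x (f x) ≤ 0) (hg : ∀ x, ∃ c : ℝ, 0 ≤ c ∧ g x = c • f x) (x : E) :
    fderiv ℝ W x (g x) ≤ 0 := by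
  obtain ⟨c, hc, h⟩ := hg x
  rw [h, map_smul, smul_eq_mul]
  exact mul_nonpos_of_nonneg_of_nonpos hc (hf x)

theorem isStable_of_isLyapunovFunction [FiniteDimensional ℝ E] {f : E → E} {W : E → ℝ} {xs : E}
    (hf : ContDiff ℝ 1 f) (hW : IsLyapunovFunction f W xs) : IsStable f xs := by
  obtain ⟨hd, hmin, hdec⟩ := hW
  have : CompleteSpace E := FiniteDimensional.complete ℝ E
  intro ε hε
  obtain ⟨δ, hδ, htrap⟩ := hmin.trapping hd hε
  refine ⟨δ, hδ, fun x₀ hx₀ => ⟨?_, fun τ x hx0 hx => htrap f hdec τ x (by rwa [hx0]) hx⟩⟩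
  -- The cut-off field has a global solution; trapping holds for this field too and confines the
  -- solution to the ball where both fields agree.
  obtain ⟨g, K, L, hK, hL, hgf, heq⟩ := exists_cutoff hf xs hε
  obtain ⟨x, hx0, hx⟩ := exists_solution_of_lipschitz_of_bounded hK hL x₀
  refine ⟨x, hx0, hx.congr_field fun t ht => heq _ ?_⟩
  exact (htrap g (fderiv_nonpos_of_nonneg_smul hdec hgf) t x (by rwa [hx0])
    (hx.mono Icc_subset_Ici_self) t ⟨ht, le_rfl⟩).le

/-- Invariance principle: if `W` decreases along a solution that stays in a compact set, and all
solutions in this set with vanishing output converge to a stable equilibrium, then so does the given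
solution. -/
theorem tendsto_of_isDetectableOn [FiniteDimensional ℝ E] {Y : Type*} [Zero Y]
    {f : E → E} {W : E → ℝ} {h : E → Y} {xs : E} {C : Set E} (hf : ContDiff ℝ 1 f)
    (hW : Differentiable ℝ W) (hdec : ∀ x, fderiv ℝ W x (f x) ≤ 0)
    (hout : ∀ x, fderiv ℝ W x (f x) = 0 → h x = 0) (hst : IsStable f xs)
    (hC : IsCompact C) (hdet : IsDetectableOn f h xs C) {x : ℝ → E}
    (hx : IsSolutionOn f x (Ici 0)) (hxC : ∀ t, 0 ≤ t → x t ∈ C) : Tendsto x atTop (𝓝 xs) := by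
  have : CompleteSpace E := FiniteDimensional.complete ℝ E
  have hanti := hx.antitoneOn hW hdec (convex_Ici 0)
  obtain ⟨c, hc⟩ : ∃ c, Tendsto (fun t => W (x t)) atTop (𝓝 c) := by
    obtain ⟨b, hb⟩ := (hC.image hW.continuous).bddBelow
    have hanti' : Antitone fun t => W (x (max t 0)) := fun s t hst =>
      hanti (mem_Ici.2 (le_max_right _ _)) (mem_Ici.2 (le_max_right _ _)) (max_le_max_right _ hst)
    have hbdd : BddBelow (range fun t => W (x (max t 0))) := by
      refine ⟨b, ?_⟩
      rintro _ ⟨t, rfl⟩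
      exact hb ⟨_, hxC _ (le_max_right _ _), rfl⟩
    refine ⟨_, (tendsto_atTop_ciInf hanti' hbdd).congr' ?_⟩
    filter_upwards [eventually_ge_atTop 0] with t ht
    rw [max_eq_left ht]
  -- an accumulation point of the solution
  obtain ⟨y, hyC, φ, hφ, hφy⟩ := hC.tendsto_subseq (x := fun n : ℕ => x n)
    (fun n => hxC n n.cast_nonneg)
  have hφt : Tendsto (fun n => (φ n : ℝ)) atTop atTop :=
    tendsto_natCast_atTop_atTop.comp hφ.tendsto_atTop
  obtain ⟨R, hR, hCR⟩ : ∃ R > 0, C ⊆ Metric.closedBall xs R := by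
    obtain ⟨R, hR⟩ := hC.isBounded.subset_closedBall xs
    exact ⟨max R 1, by positivity, hR.trans (Metric.closedBall_subset_closedBall (le_max_left _ _))⟩
  -- A globally Lipschitz field equal to f on C: it provides the solution through y for all future
  -- times and makes Grönwall's estimate available.
  obtain ⟨g, K, L, hK, hL, -, heq⟩ := exists_cutoff hf xs hR
  obtain ⟨ψ, hψ0, hψ⟩ := exists_solution_of_lipschitz_of_bounded hK hL y
  have hshift : ∀ n : ℕ, IsSolutionOn g (fun t => x (t + φ n)) (Ici 0) := by
    intro n t ht
    have ht : (0 : ℝ) ≤ t := ht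
    have hn : (0 : ℝ) ≤ φ n := Nat.cast_nonneg _
    change HasDerivWithinAt _ (g (x (t + φ n))) _ _
    rw [heq _ (hCR (hxC _ (by positivity)))]
    have h1 := hx (t + φ n) (by simp only [mem_Ici]; positivity)
    have h2 : HasDerivWithinAt (fun u : ℝ => u + φ n) 1 (Ici 0) t :=
      ((hasDerivAt_id t).add_const _).hasDerivWithinAt
    have := h1.scomp t h2 (fun u (hu : (0 : ℝ) ≤ u) => by simp only [mem_Ici]; positivity)
    rwa [one_smul] at this
  -- the solution through it is a limit of time shifts
  have hlim : ∀ t, 0 ≤ t → Tendsto (fun n => x (t + φ n)) atTop (𝓝 (ψ t)) := by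
    intro t ht
    rw [tendsto_iff_dist_tendsto_zero]
    have hb : ∀ n, dist (x (t + φ n)) (ψ t) ≤ dist (x (φ n)) y * Real.exp (K * (t - 0)) := by
      intro n
      refine dist_le_of_trajectories_ODE (v := fun _ => g) (f := fun t => x (t + φ n)) (g := ψ)
        (a := 0) (b := t) (fun _ => hK)
        ((hshift n).continuousOn.mono Icc_subset_Ici_self)
        (fun u hu => (hshift n u hu.1).mono (Ici_subset_Ici.2 hu.1))
        (hψ.continuousOn.mono Icc_subset_Ici_self)
        (fun u hu => (hψ u hu.1).mono (Ici_subset_Ici.2 hu.1)) ?_ t ⟨ht, le_rfl⟩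
      simp [hψ0]
    refine squeeze_zero (fun _ => dist_nonneg) hb ?_
    simpa using (tendsto_iff_dist_tendsto_zero.1 hφy).mul_const (Real.exp (K * (t - 0)))
  have hψC : ∀ t, 0 ≤ t → ψ t ∈ C := fun t ht =>
    hC.isClosed.mem_of_tendsto (hlim t ht)
      (Eventually.of_forall fun n => hxC _ (add_nonneg ht (Nat.cast_nonneg _)))
  have hψf : IsSolutionOn f ψ (Ici 0) := hψ.congr_field fun t ht => heq _ (hCR (hψC t ht))
  -- W(ψ(t)) is a limit of values of W along the solution at times tending to infinity.
  have hψW : ∀ t, 0 ≤ t → W (ψ t) = c := fun t ht =>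
    tendsto_nhds_unique ((hW.continuous.tendsto _).comp (hlim t ht))
      (hc.comp (tendsto_atTop_add_const_left _ t hφt))
  have hψh : ∀ t, 0 ≤ t → h (ψ t) = 0 := by
    intro t ht
    refine hout _ ?_
    have h1 := hψf.hasDerivWithinAt_comp hW ht
    have h2 : HasDerivWithinAt (W ∘ ψ) 0 (Ici 0) t :=
      (hasDerivWithinAt_const t _ c).congr (fun u hu => hψW u hu) (hψW t ht)
    exact (uniqueDiffOn_Ici 0 t ht).eq_deriv _ h1 h2
  have hψlim := hdet ψ hψf hψC hψh
  -- so the solution gets arbitrarily close to the equilibrium, and stays there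
  rw [Metric.tendsto_atTop]
  intro ε hε
  obtain ⟨δ, hδ, hstab⟩ := hst ε hε
  obtain ⟨t, ht, ht0⟩ := ((hψlim.eventually (Metric.ball_mem_nhds xs hδ)).and
    (eventually_ge_atTop 0)).exists
  obtain ⟨n, hn⟩ := ((hlim t ht0).eventually (Metric.isOpen_ball.mem_nhds ht)).exists
  have hn0 : (0 : ℝ) ≤ t + φ n := add_nonneg ht0 (Nat.cast_nonneg _)
  refine ⟨t + φ n, fun u hu => ?_⟩
  have hsol : IsSolutionOn f (fun r => x (r + (t + φ n))) (Icc 0 (u - (t + φ n))) := by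
    intro r hr
    have h1 := hx (r + (t + φ n)) (by simp only [mem_Ici]; linarith [hr.1])
    have h2 : HasDerivWithinAt (fun r : ℝ => r + (t + φ n)) 1 (Icc 0 (u - (t + φ n))) r :=
      ((hasDerivAt_id r).add_const _).hasDerivWithinAt
    have := h1.scomp r h2 (fun v hv => by simp only [mem_Ici]; linarith [hv.1])
    rwa [one_smul] at this
  have := (hstab (x (t + φ n)) hn).2 _ (fun r => x (r + (t + φ n))) (by simp) hsol
    (u - (t + φ n)) ⟨by linarith, le_rfl⟩
  simpa using this

theorem isAsymptoticallyStable_of_isDetectableOn [FiniteDimensional ℝ E] {Y : Type*} [Zero Y]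
    {f : E → E} {W : E → ℝ} {h : E → Y} {xs : E} {U : Set E} (hf : ContDiff ℝ 1 f)
    (hW : IsLyapunovFunction f W xs) (hout : ∀ x, fderiv ℝ W x (f x) = 0 → h x = 0)
    (hU : U ∈ 𝓝 xs) (hdet : IsDetectableOn f h xs U) : IsAsymptoticallyStable f xs := by
  have : ProperSpace E := FiniteDimensional.proper_real E
  have hst := isStable_of_isLyapunovFunction hf hW
  obtain ⟨ε, hε, hball⟩ := Metric.nhds_basis_closedBall.mem_iff.1 hU
  obtain ⟨δ, hδ, hstab⟩ := hst ε hε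
  refine ⟨hst, δ, hδ, fun x hx0 hx => ?_⟩
  refine tendsto_of_isDetectableOn hf hW.1 hW.2.2 hout hst (isCompact_closedBall xs ε)
    (fun y hy hyC => hdet y hy fun t ht => hball (hyC t ht)) hx fun t ht => ?_
  exact ((hstab _ hx0).2 t x rfl (hx.mono Icc_subset_Ici_self) t ⟨ht, le_rfl⟩).le

theorem IsSolutionOn.mem_sublevel {f : E → E} {W : E → ℝ} (hW : Differentiable ℝ W)
    (hf : ∀ x, fderiv ℝ W x (f x) ≤ 0) {x : ℝ → E} {τ : ℝ} (hx : IsSolutionOn f x (Icc 0 τ))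
    {c : ℝ} (hc : W (x 0) ≤ c) {t : ℝ} (ht : t ∈ Icc 0 τ) : W (x t) ≤ c :=
  (hx.antitoneOn hW hf (convex_Icc 0 τ) ⟨le_rfl, ht.1.trans ht.2⟩ ht ht.1).trans hc

/-- Sublevel sets of W are forward invariant; being bounded, they rule out finite escape and bound
all solutions that start in a given ball. -/
theorem isGloballyStable_of_isBounded_sublevel [FiniteDimensional ℝ E] {f : E → E} {W : E → ℝ}
    {xs : E} (hf : ContDiff ℝ 1 f) (hW : IsLyapunovFunction f W xs)
    (hbdd : ∀ c, Bornology.IsBounded {x | W x ≤ c}) : IsGloballyStable f xs := by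
  have : ProperSpace E := FiniteDimensional.proper_real E
  have hball : ∀ c, ∃ R > 0, ∀ x, W x ≤ c → dist x xs < R := by
    intro c
    obtain ⟨R, hR⟩ := (hbdd c).subset_ball xs
    exact ⟨max R 1, by positivity, fun x hx =>
      (Metric.mem_ball.1 (hR hx)).trans_le (le_max_left _ _)⟩
  refine ⟨isStable_of_isLyapunovFunction hf hW, fun x₀ => ?_, fun r _ => ?_⟩
  · obtain ⟨R, hR, hWR⟩ := hball (W x₀)
    obtain ⟨g, K, L, hK, hL, hgf, heq⟩ := exists_cutoff hf xs hR
    obtain ⟨x, hx0, hx⟩ := exists_solution_of_lipschitz_of_bounded hK hL x₀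
    refine ⟨x, hx0, hx.congr_field fun t ht => heq _ (hWR _ ?_).le⟩
    exact (hx.mono Icc_subset_Ici_self).mem_sublevel hW.1
      (fderiv_nonpos_of_nonneg_smul hW.2.2 hgf) (by rw [hx0]) ⟨ht, le_rfl⟩
  · obtain ⟨c, hc⟩ := ((isCompact_closedBall xs r).image hW.1.continuous).bddAbove
    obtain ⟨R, hR, hWR⟩ := hball c
    refine ⟨R, hR, fun τ x hx0 hx t ht => hWR _ ?_⟩
    exact hx.mem_sublevel hW.1 hW.2.2 (hc ⟨x 0, Metric.mem_closedBall.2 hx0.le, rfl⟩) ht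

theorem isGloballyAsymptoticallyStable_of_isDetectableOn [FiniteDimensional ℝ E] {Y : Type*}
    [Zero Y] {f : E → E} {W : E → ℝ} {h : E → Y} {xs : E} (hf : ContDiff ℝ 1 f)
    (hW : IsLyapunovFunction f W xs) (hout : ∀ x, fderiv ℝ W x (f x) = 0 → h x = 0)
    (hbdd : ∀ c, Bornology.IsBounded {x | W x ≤ c}) (hdet : IsDetectableOn f h xs univ) :
    IsGloballyAsymptoticallyStable f xs := by
  have : ProperSpace E := FiniteDimensional.proper_real E
  have hst := isGloballyStable_of_isBounded_sublevel hf hW hbdd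
  refine ⟨hst, fun x hx => ?_⟩
  refine tendsto_of_isDetectableOn hf hW.1 hW.2.2 hout hst.1
    (Metric.isCompact_of_isClosed_isBounded
      (isClosed_le hW.1.continuous continuous_const) (hbdd (W (x 0))))
    (fun y hy _ => hdet y hy fun t _ => mem_univ _) hx fun t ht => ?_
  exact (hx.mono Icc_subset_Ici_self).mem_sublevel hW.1 hW.2.2 le_rfl ⟨ht, le_rfl⟩

end Dynamics

end IntegralAction

namespace IntegralAction

/-! ### Quadratic forms and rank. -/

section MatrixLemmas

variable {ι κ : Type*} [Fintype ι] [Fintype κ]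

theorem isUnit_of_rank_eq_card [DecidableEq ι] {A : Matrix ι ι ℝ} (h : A.rank = Fintype.card ι) :
    IsUnit A := by
  rw [← Matrix.mulVec_surjective_iff_isUnit]
  have : LinearMap.range A.mulVecLin = ⊤ :=
    Submodule.eq_top_of_finrank_eq (by rw [Module.finrank_fintype_fun_eq_card]; exact h)
  exact LinearMap.range_eq_top.1 this

theorem dotProduct_mulVec_comm (A : Matrix ι κ ℝ) (v : ι → ℝ) (w : κ → ℝ) :
    v ⬝ᵥ A *ᵥ w = w ⬝ᵥ Aᵀ *ᵥ v := by
  rw [Matrix.dotProduct_mulVec, dotProduct_comm, Matrix.mulVec_transpose]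

theorem dotProduct_mulVec_self_of_skew {A : Matrix ι ι ℝ} (hA : Aᵀ = -A) (v : ι → ℝ) :
    v ⬝ᵥ A *ᵥ v = 0 := by
  have h := dotProduct_mulVec_comm A v v
  rw [hA, Matrix.neg_mulVec, dotProduct_neg] at h
  linarith

theorem transpose_of_posDef {ι : Type*} {A : Matrix ι ι ℝ} (hA : A.PosDef) : Aᵀ = A := by
  simpa using hA.isHermitian.eq

theorem dotProduct_mulVec_pos {A : Matrix ι ι ℝ} (hA : A.PosDef) {v : ι → ℝ} (hv : v ≠ 0) :
    0 < v ⬝ᵥ A *ᵥ v := by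
  simpa using hA.dotProduct_mulVec_pos hv

theorem dotProduct_mulVec_nonneg {A : Matrix ι ι ℝ} (hA : A.PosDef) (v : ι → ℝ) :
    0 ≤ v ⬝ᵥ A *ᵥ v := by
  simpa using hA.posSemidef.dotProduct_mulVec_nonneg v

theorem eq_zero_of_dotProduct_mulVec_nonpos {A : Matrix ι ι ℝ} (hA : A.PosDef) {v : ι → ℝ}
    (h : v ⬝ᵥ A *ᵥ v ≤ 0) : v = 0 := by
  by_contra hv
  exact (dotProduct_mulVec_pos hA hv).not_ge h

theorem quadratic_add_smul {A : Matrix ι ι ℝ} (hA : Aᵀ = A) (v w : ι → ℝ) (t : ℝ) :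
    (v + t • w) ⬝ᵥ A *ᵥ (v + t • w)
      = v ⬝ᵥ A *ᵥ v + 2 * t * (w ⬝ᵥ A *ᵥ v) + t ^ 2 * (w ⬝ᵥ A *ᵥ w) := by
  have h : v ⬝ᵥ A *ᵥ w = w ⬝ᵥ A *ᵥ v := by rw [dotProduct_mulVec_comm, hA]
  simp only [Matrix.mulVec_add, Matrix.mulVec_smul, add_dotProduct, dotProduct_add,
    smul_dotProduct, dotProduct_smul, smul_eq_mul, h]
  ring

/-- A Cauchy–Schwarz inequality bounding the coordinates of `v` by a quadratic form in `v`. -/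
theorem sq_apply_le_trace_mul [DecidableEq ι] {A : Matrix ι ι ℝ} (hA : A.PosDef) (v : ι → ℝ)
    (i : ι) : v i ^ 2 ≤ A.trace * (v ⬝ᵥ A⁻¹ *ᵥ v) := by
  have hinv : A⁻¹ *ᵥ (A *ᵥ Pi.single i 1) = Pi.single i 1 := by
    rw [Matrix.mulVec_mulVec, Matrix.nonsing_inv_mul _ ((A.isUnit_iff_isUnit_det).1 hA.isUnit),
      Matrix.one_mulVec]
  have hsymm : (A⁻¹)ᵀ = A⁻¹ := transpose_of_posDef hA.inv
  have hdiag : 0 < A i i := hA.diag_pos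
  have hle : A i i ≤ A.trace :=
    Finset.single_le_sum (f := fun j => A j j) (fun j _ => hA.diag_pos.le) (Finset.mem_univ i)
  have hQ := dotProduct_mulVec_nonneg hA.inv v
  -- This is v minus its projection onto A eᵢ, orthogonal for the inner product of A⁻¹.
  have h := dotProduct_mulVec_nonneg hA.inv (v + (-(v i / A i i)) • (A *ᵥ Pi.single i 1))
  have h0 : (A *ᵥ Pi.single i 1) ⬝ᵥ A⁻¹ *ᵥ v = v i := by
    rw [dotProduct_mulVec_comm, hsymm, hinv, dotProduct_single, mul_one]
  have h1 : (A *ᵥ Pi.single i 1) ⬝ᵥ (Pi.single i 1 : ι → ℝ) = A i i := by simp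
  rw [quadratic_add_smul hsymm, h0, hinv, h1] at h
  have h2 : v i ^ 2 ≤ A i i * (v ⬝ᵥ A⁻¹ *ᵥ v) := by
    have := mul_nonneg hdiag.le h
    field_simp at this
    nlinarith
  exact h2.trans (mul_le_mul_of_nonneg_right hle hQ)

end MatrixLemmas

/-! ### Smoothness of matrix expressions, gradients and Jacobians. -/

section Smoothness

variable {X : Type*} [NormedAddCommGroup X] [NormedSpace ℝ X] {k : WithTop ℕ∞}
  {ι κ μ : Type*}

theorem contDiff_matrix_mul [Fintype κ] {A : X → Matrix ι κ ℝ} {B : X → Matrix κ μ ℝ}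
    (hA : ∀ i j, ContDiff ℝ k fun x => A x i j) (hB : ∀ i j, ContDiff ℝ k fun x => B x i j) (i j) :
    ContDiff ℝ k fun x => (A x * B x) i j := by
  simp only [Matrix.mul_apply]
  exact ContDiff.sum fun l _ => (hA i l).mul (hB l j)

theorem contDiff_mulVec [Fintype ι] [Fintype κ] {A : X → Matrix ι κ ℝ} {v : X → κ → ℝ}
    (hA : ∀ i j, ContDiff ℝ k fun x => A x i j) (hv : ContDiff ℝ k v) :
    ContDiff ℝ k fun x => A x *ᵥ v x := by
  refine contDiff_pi.2 fun i => ?_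
  simp only [Matrix.mulVec, dotProduct]
  exact ContDiff.sum fun l _ => (hA i l).mul (contDiff_pi.1 hv l)

theorem contDiff_dotProduct [Fintype ι] {v w : X → ι → ℝ} (hv : ContDiff ℝ k v)
    (hw : ContDiff ℝ k w) : ContDiff ℝ k fun x => v x ⬝ᵥ w x := by
  simp only [dotProduct]
  exact ContDiff.sum fun l _ => (contDiff_pi.1 hv l).mul (contDiff_pi.1 hw l)

theorem contDiff_sumElim [Fintype ι] [Fintype κ] {v : X → ι → ℝ} {w : X → κ → ℝ}
    (hv : ContDiff ℝ k v) (hw : ContDiff ℝ k w) : ContDiff ℝ k fun x => Sum.elim (v x) (w x) := by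
  refine contDiff_pi.2 fun i => ?_
  cases i
  · exact contDiff_pi.1 hv _
  · exact contDiff_pi.1 hw _

theorem contDiff_det [Fintype ι] [DecidableEq ι] {A : X → Matrix ι ι ℝ}
    (hA : ∀ i j, ContDiff ℝ k fun x => A x i j) : ContDiff ℝ k fun x => (A x).det := by
  simp only [Matrix.det_apply]
  exact ContDiff.sum fun σ _ => (contDiff_prod fun i _ => hA _ _).const_smul _

/-- By Cramer's rule the entries are quotients of polynomials in the entries of A, with nonvanishing
denominator det A. -/
theorem contDiff_matrix_inv [Fintype ι] [DecidableEq ι] {A : X → Matrix ι ι ℝ}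
    (hA : ∀ i j, ContDiff ℝ k fun x => A x i j) (hu : ∀ x, IsUnit (A x)) (i j) :
    ContDiff ℝ k fun x => (A x)⁻¹ i j := by
  simp only [Matrix.inv_def, Ring.inverse_eq_inv', Matrix.smul_apply, smul_eq_mul,
    Matrix.adjugate_apply]
  refine ContDiff.mul ((contDiff_det hA).inv fun x =>
    ((A x).isUnit_iff_isUnit_det.1 (hu x)).ne_zero) (contDiff_det fun a b => ?_)
  by_cases h : a = j
  · subst h
    simp only [Matrix.updateRow_self]
    exact contDiff_const
  · simp only [Matrix.updateRow_ne h]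
    exact hA a b

theorem fderiv_eq_grad_dotProduct [Fintype ι] [DecidableEq ι] (h : (ι → ℝ) → ℝ) (x v : ι → ℝ) :
    fderiv ℝ h x v = grad h x ⬝ᵥ v := by
  have := LinearMap.pi_apply_eq_sum_univ (fderiv ℝ h x : (ι → ℝ) →ₗ[ℝ] ℝ) v
  simp only [ContinuousLinearMap.coe_coe] at this
  rw [this]
  simp only [dotProduct, grad, smul_eq_mul]
  refine Finset.sum_congr rfl fun i _ => ?_
  rw [mul_comm]
  congr 2
  ext j
  simp [Pi.single_apply, eq_comm]

theorem contDiff_grad [Fintype ι] [DecidableEq ι] {h : X → (ι → ℝ) → ℝ} {g : X → ι → ℝ}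
    (hh : ContDiff ℝ 2 (Function.uncurry h)) (hg : ContDiff ℝ 1 g) :
    ContDiff ℝ 1 fun x => grad (h x) (g x) :=
  contDiff_pi.2 fun _ => (hh.fderiv hg (by norm_num)).clm_apply contDiff_const

theorem contDiff_jacobian [Fintype ι] [DecidableEq ι] [Fintype κ] {h : X → (ι → ℝ) → κ → ℝ}
    {g : X → ι → ℝ} (hh : ContDiff ℝ 2 (Function.uncurry h)) (hg : ContDiff ℝ 1 g) (i j) :
    ContDiff ℝ 1 fun x => jacobian (h x) (g x) i j :=
  contDiff_pi.1 ((hh.fderiv hg (by norm_num)).clm_apply contDiff_const) i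

theorem fderiv_quadratic [Fintype ι] {A : Matrix ι ι ℝ} (hA : Aᵀ = A) (x v : ι → ℝ) :
    fderiv ℝ (fun y => 1 / 2 * (y ⬝ᵥ A *ᵥ y)) x v = (A *ᵥ x) ⬝ᵥ v := by
  have hd : ContDiff ℝ 1 fun y : ι → ℝ => 1 / 2 * (y ⬝ᵥ A *ᵥ y) :=
    contDiff_const.mul (contDiff_dotProduct contDiff_id
      (contDiff_mulVec (fun _ _ => contDiff_const) contDiff_id))
  -- Along a line the form is a quadratic polynomial in t, and its linear coefficient is the
  -- derivative sought.
  rw [← (hd.differentiable one_ne_zero x).lineDeriv_eq_fderiv, lineDeriv]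
  simp only [quadratic_add_smul hA]
  have h : HasDerivAt (fun t : ℝ => 1 / 2 *
      (x ⬝ᵥ A *ᵥ x + 2 * t * (v ⬝ᵥ A *ᵥ x) + t ^ 2 * (v ⬝ᵥ A *ᵥ v)))
      (1 / 2 * (2 * 1 * (v ⬝ᵥ A *ᵥ x) + (2 : ℕ) * 0 ^ (2 - 1) * 1 * (v ⬝ᵥ A *ᵥ v))) 0 :=
    (((((hasDerivAt_id (0 : ℝ)).const_mul 2).mul_const _).const_add _).add
      (((hasDerivAt_id (0 : ℝ)).pow 2).mul_const _)).const_mul _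
  rw [h.deriv, dotProduct_comm v]
  norm_num
  ring

end Smoothness

end IntegralAction

namespace IntegralAction

/-! ### The shaped mechanical system: regularity, skew-symmetry and critical points. -/

namespace MechSystem

variable {m s : ℕ} (P : MechSystem m s)

theorem isUnit_GtG (q : Idx m s → ℝ) : IsUnit ((P.G q)ᵀ * P.G q) :=
  isUnit_of_rank_eq_card (by rw [Matrix.rank_transpose_mul_self, P.G_rank, Fintype.card_fin])

theorem isUnit_Gperp_mul_transpose (q : Idx m s → ℝ) : IsUnit (P.Gperp q * (P.Gperp q)ᵀ) :=
  isUnit_of_rank_eq_card (by rw [Matrix.rank_self_mul_transpose, P.Gperp_rank, Fintype.card_fin])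

/-- An explicit right inverse is [G, G⊥ᵀ(G⊥G⊥ᵀ)⁻¹], because G⊥G = 0 removes the off-diagonal blocks.
-/
theorem isUnit_T (q : Idx m s → ℝ) : IsUnit (P.T q) := by
  have h1 : P.Gplus q * P.G q = 1 := by
    rw [Gplus, Matrix.mul_assoc, Matrix.nonsing_inv_mul _
      ((Matrix.isUnit_iff_isUnit_det _).1 (P.isUnit_GtG q))]
  have h2 : P.Gplus q * (P.Gperp q)ᵀ = 0 := by
    rw [Gplus, Matrix.mul_assoc, ← Matrix.transpose_mul, P.Gperp_mul_G, Matrix.transpose_zero,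
      Matrix.mul_zero]
  have h : P.T q * Matrix.fromCols (P.G q)
      ((P.Gperp q)ᵀ * (P.Gperp q * (P.Gperp q)ᵀ)⁻¹) = 1 := by
    rw [T, Matrix.fromRows_mul_fromCols, h1, P.Gperp_mul_G, ← Matrix.mul_assoc,
      ← Matrix.mul_assoc, h2, Matrix.zero_mul, Matrix.mul_nonsing_inv _
      ((Matrix.isUnit_iff_isUnit_det _).1 (P.isUnit_Gperp_mul_transpose q)), Matrix.fromBlocks_one]
  exact IsUnit.of_mul_eq_one _ h

theorem MdT_posDef (q : Idx m s → ℝ) : (P.MdT q).PosDef := by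
  have h := (P.Md_posDef q).mul_mul_conjTranspose_same (B := P.T q)
    (Matrix.vecMul_injective_iff_isUnit.2 (P.isUnit_T q))
  rwa [Matrix.conjTranspose_eq_transpose_of_trivial] at h

theorem Gplus_smooth (i j) : ContDiff ℝ 2 fun q => P.Gplus q i j := by
  have hGt : ∀ i j, ContDiff ℝ 2 fun q => (P.G q)ᵀ i j := fun i j => P.G_smooth j i
  exact contDiff_matrix_mul
    (contDiff_matrix_inv (contDiff_matrix_mul hGt P.G_smooth) P.isUnit_GtG) hGt i j

theorem T_smooth (i j) : ContDiff ℝ 2 fun q => P.T q i j := by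
  cases i
  · exact P.Gplus_smooth _ j
  · exact P.Gperp_smooth _ j

theorem T_inv_smooth (i j) : ContDiff ℝ 2 fun q => (P.T q)⁻¹ i j :=
  contDiff_matrix_inv P.T_smooth P.isUnit_T i j

theorem MdT_smooth (i j) : ContDiff ℝ 2 fun q => P.MdT q i j :=
  contDiff_matrix_mul (contDiff_matrix_mul P.T_smooth P.Md_smooth)
    (fun i j => P.T_smooth j i) i j

theorem MdT_inv_smooth (i j) : ContDiff ℝ 2 fun q => (P.MdT q)⁻¹ i j :=
  contDiff_matrix_inv P.MdT_smooth (fun q => (P.MdT_posDef q).isUnit) i j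

section Comp

variable {X : Type*} [NormedAddCommGroup X] [NormedSpace ℝ X] {k : WithTop ℕ∞}
  {q : X → Idx m s → ℝ} {p₁ : X → Fin m → ℝ} {p₂ : X → Fin s → ℝ}

theorem contDiff_Hd (hq : ContDiff ℝ 2 q) (h₁ : ContDiff ℝ 2 p₁) (h₂ : ContDiff ℝ 2 p₂) :
    ContDiff ℝ 2 fun x => P.Hd (q x) (p₁ x) (p₂ x) :=
  (contDiff_const.mul (contDiff_dotProduct (contDiff_sumElim h₁ h₂)
    (contDiff_mulVec (fun i j => (P.MdT_inv_smooth i j).comp hq) (contDiff_sumElim h₁ h₂)))).add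
      (P.Vd_smooth.comp hq)

theorem contDiff_Hd_uncurried : ContDiff ℝ 2
    fun x : (Idx m s → ℝ) × (Fin m → ℝ) × (Fin s → ℝ) => P.Hd x.1 x.2.1 x.2.2 :=
  P.contDiff_Hd contDiff_fst contDiff_snd.fst contDiff_snd.snd

theorem contDiff_gradq (hq : ContDiff ℝ 1 q) (h₁ : ContDiff ℝ 1 p₁) (h₂ : ContDiff ℝ 1 p₂) :
    ContDiff ℝ 1 fun x => P.gradq (q x) (p₁ x) (p₂ x) :=
  (contDiff_grad (h := fun (x : (Idx m s → ℝ) × (Fin m → ℝ) × (Fin s → ℝ)) q' =>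
    P.Hd q' x.2.1 x.2.2) (P.contDiff_Hd contDiff_snd contDiff_fst.snd.fst contDiff_fst.snd.snd)
    contDiff_fst).comp (hq.prodMk (h₁.prodMk h₂))

theorem contDiff_gradp₁ (hq : ContDiff ℝ 1 q) (h₁ : ContDiff ℝ 1 p₁) (h₂ : ContDiff ℝ 1 p₂) :
    ContDiff ℝ 1 fun x => P.gradp₁ (q x) (p₁ x) (p₂ x) :=
  (contDiff_grad (h := fun (x : (Idx m s → ℝ) × (Fin m → ℝ) × (Fin s → ℝ)) p' =>
    P.Hd x.1 p' x.2.2) (P.contDiff_Hd contDiff_fst.fst contDiff_snd contDiff_fst.snd.snd)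
    contDiff_snd.fst).comp (hq.prodMk (h₁.prodMk h₂))

theorem contDiff_gradp₂ (hq : ContDiff ℝ 1 q) (h₁ : ContDiff ℝ 1 p₁) (h₂ : ContDiff ℝ 1 p₂) :
    ContDiff ℝ 1 fun x => P.gradp₂ (q x) (p₁ x) (p₂ x) :=
  (contDiff_grad (h := fun (x : (Idx m s → ℝ) × (Fin m → ℝ) × (Fin s → ℝ)) p' =>
    P.Hd x.1 x.2.1 p') (P.contDiff_Hd contDiff_fst.fst contDiff_fst.snd.fst contDiff_snd)
    contDiff_snd.snd).comp (hq.prodMk (h₁.prodMk h₂))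

theorem contDiff_jacTinv {p : X → Idx m s → ℝ} (hq : ContDiff ℝ 1 q) (hp : ContDiff ℝ 1 p) (i j) :
    ContDiff ℝ 1 fun x => P.jacTinv (q x) (p x) i j :=
  (contDiff_jacobian (h := fun (x : (Idx m s → ℝ) × (Idx m s → ℝ)) q' => (P.T q')⁻¹ *ᵥ x.2)
    (contDiff_mulVec (fun i j => (P.T_inv_smooth i j).comp contDiff_snd) contDiff_fst.snd)
    contDiff_fst i j).comp (hq.prodMk hp)

theorem contDiff_M_inv (hq : ContDiff ℝ 1 q) (i j) :
    ContDiff ℝ 1 fun x => (P.M (q x))⁻¹ i j :=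
  contDiff_matrix_inv (fun i j => (P.M_smooth i j).comp hq) (fun x => (P.M_posDef (q x)).isUnit) i j

theorem contDiff_Md (hq : ContDiff ℝ 1 q) (i j) : ContDiff ℝ 1 fun x => P.Md (q x) i j :=
  ((P.Md_smooth i j).of_le one_le_two).comp hq

theorem contDiff_G (hq : ContDiff ℝ 1 q) (i j) : ContDiff ℝ 1 fun x => P.G (q x) i j :=
  ((P.G_smooth i j).of_le one_le_two).comp hq

theorem contDiff_Gperp (hq : ContDiff ℝ 1 q) (i j) : ContDiff ℝ 1 fun x => P.Gperp (q x) i j :=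
  ((P.Gperp_smooth i j).of_le one_le_two).comp hq

theorem contDiff_GtG_inv (hq : ContDiff ℝ 1 q) (i j) :
    ContDiff ℝ 1 fun x => ((P.G (q x))ᵀ * P.G (q x))⁻¹ i j :=
  contDiff_matrix_inv (contDiff_matrix_mul (fun i j => P.contDiff_G hq j i) (P.contDiff_G hq))
    (fun x => P.isUnit_GtG (q x)) i j

theorem contDiff_Jp (hq : ContDiff ℝ 1 q) (h₁ : ContDiff ℝ 1 p₁) (h₂ : ContDiff ℝ 1 p₂) (i j) :
    ContDiff ℝ 1 fun x => P.Jp (q x) (p₁ x) (p₂ x) i j := by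
  have hp := contDiff_sumElim h₁ h₂
  have hB := P.contDiff_jacTinv hq hp
  refine ContDiff.add (ContDiff.sub
    (contDiff_matrix_mul (contDiff_matrix_mul (P.contDiff_Md hq) (P.contDiff_M_inv hq))
      (fun i j => hB j i) i j)
    (contDiff_matrix_mul (contDiff_matrix_mul hB (P.contDiff_M_inv hq)) (P.contDiff_Md hq) i j))
    ((P.J2_smooth i j).comp (hq.prodMk
      (contDiff_mulVec (fun i j => ((P.T_inv_smooth i j).of_le one_le_two).comp hq) hp)))

theorem contDiff_S₁ (hq : ContDiff ℝ 1 q) (i j) : ContDiff ℝ 1 fun x => P.S₁ (q x) i j :=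
  contDiff_matrix_mul (contDiff_matrix_mul (contDiff_matrix_mul (P.contDiff_M_inv hq)
    (P.contDiff_Md hq)) (P.contDiff_G hq)) (P.contDiff_GtG_inv hq) i j

theorem contDiff_S₂ (hq : ContDiff ℝ 1 q) (i j) : ContDiff ℝ 1 fun x => P.S₂ (q x) i j :=
  contDiff_matrix_mul (contDiff_matrix_mul (P.contDiff_M_inv hq) (P.contDiff_Md hq))
    (fun i j => P.contDiff_Gperp hq j i) i j

theorem contDiff_S₃₂ (hq : ContDiff ℝ 1 q) (h₁ : ContDiff ℝ 1 p₁) (h₂ : ContDiff ℝ 1 p₂) (i j) :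
    ContDiff ℝ 1 fun x => P.S₃₂ (q x) (p₁ x) (p₂ x) i j :=
  contDiff_matrix_mul (contDiff_matrix_mul (contDiff_matrix_mul (P.contDiff_GtG_inv hq)
    (fun i j => P.contDiff_G hq j i)) (P.contDiff_Jp hq h₁ h₂))
    (fun i j => P.contDiff_Gperp hq j i) i j

theorem contDiff_S₃₄ (hq : ContDiff ℝ 1 q) (h₁ : ContDiff ℝ 1 p₁) (h₂ : ContDiff ℝ 1 p₂) (i j) :
    ContDiff ℝ 1 fun x => P.S₃₄ (q x) (p₁ x) (p₂ x) i j :=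
  contDiff_matrix_mul (contDiff_matrix_mul (P.contDiff_Gperp hq) (P.contDiff_Jp hq h₁ h₂))
    (fun i j => P.contDiff_Gperp hq j i) i j

end Comp

/-- The first two terms of J_p are a matrix minus its transpose, as M and M_d are symmetric. What
the energy balance needs from this is `S₃₄_skew`: S₃₁ is cancelled by the controller, and S₃₂ enters
together with its negative transpose. -/
theorem Jp_skew (q : Idx m s → ℝ) (p₁ : Fin m → ℝ) (p₂ : Fin s → ℝ) :
    (P.Jp q p₁ p₂)ᵀ = -P.Jp q p₁ p₂ := by
  simp only [Jp, Matrix.transpose_add, Matrix.transpose_sub, Matrix.transpose_mul,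
    Matrix.transpose_transpose, transpose_of_posDef (P.M_posDef q).inv,
    transpose_of_posDef (P.Md_posDef q), P.J2_skew, Matrix.mul_assoc]
  abel

theorem S₃₄_skew (q : Idx m s → ℝ) (p₁ : Fin m → ℝ) (p₂ : Fin s → ℝ) :
    (P.S₃₄ q p₁ p₂)ᵀ = -P.S₃₄ q p₁ p₂ := by
  simp only [S₃₄, Matrix.transpose_mul, Matrix.transpose_transpose, P.Jp_skew, Matrix.mul_assoc,
    Matrix.neg_mul, Matrix.mul_neg]

theorem Hd_zero (q : Idx m s → ℝ) : P.Hd q 0 0 = P.Vd q := by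
  simp [Hd]

theorem Vd_le_Hd (q : Idx m s → ℝ) (p₁ : Fin m → ℝ) (p₂ : Fin s → ℝ) :
    P.Vd q ≤ P.Hd q p₁ p₂ := by
  have := dotProduct_mulVec_nonneg (P.MdT_posDef q).inv (Sum.elim p₁ p₂)
  simp only [Hd]
  linarith

theorem Vd_lt_Hd (q : Idx m s → ℝ) {p₁ : Fin m → ℝ} {p₂ : Fin s → ℝ} (h : p₁ ≠ 0 ∨ p₂ ≠ 0) :
    P.Vd q < P.Hd q p₁ p₂ := by
  have := dotProduct_mulVec_pos (P.MdT_posDef q).inv (v := Sum.elim p₁ p₂) (by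
    intro h0
    have h1 : p₁ = 0 := funext fun i => congrFun h0 (Sum.inl i)
    have h2 : p₂ = 0 := funext fun i => congrFun h0 (Sum.inr i)
    exact h.elim (· h1) (· h2))
  simp only [Hd]
  linarith

/-- On the slice of zero momentum the Hamiltonian is V_d in the old and the new coordinates, so the
hypothesis passes to the new ones without transporting the minimum along T. -/
theorem isStrictMin_Vd {qs : Idx m s → ℝ}
    (hmin : IsStrictMin (fun x : (Idx m s → ℝ) × (Idx m s → ℝ) => P.Hbold x.1 x.2) (qs, 0)) :
    IsStrictMin P.Vd qs := by
  have ht : Tendsto (fun q : Idx m s → ℝ => (q, (0 : Idx m s → ℝ))) (𝓝[≠] qs) (𝓝[≠] (qs, 0)) := by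
    refine tendsto_nhdsWithin_of_tendsto_nhds_of_eventually_within _ ?_ ?_
    · exact ((continuous_id.prodMk continuous_const).tendsto qs).mono_left nhdsWithin_le_nhds
    · filter_upwards [self_mem_nhdsWithin] with q hq h
      exact hq (Prod.ext_iff.1 h).1
  filter_upwards [ht.eventually hmin] with q hq
  simpa [Hbold] using hq

/-- The differential of the Hamiltonian in terms of its partial gradients. -/
theorem fderiv_Hd (q vq : Idx m s → ℝ) (p₁ v₁ : Fin m → ℝ) (p₂ v₂ : Fin s → ℝ) :
    fderiv ℝ (fun x : (Idx m s → ℝ) × (Fin m → ℝ) × (Fin s → ℝ) => P.Hd x.1 x.2.1 x.2.2)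
      (q, p₁, p₂) (vq, v₁, v₂)
      = P.gradq q p₁ p₂ ⬝ᵥ vq + P.gradp₁ q p₁ p₂ ⬝ᵥ v₁ + P.gradp₂ q p₁ p₂ ⬝ᵥ v₂ := by
  have hd := (P.contDiff_Hd_uncurried.differentiable two_ne_zero (q, p₁, p₂)).hasFDerivAt
  have e1 := (hd.comp (f := fun q' => (q', p₁, p₂)) q (hasFDerivAt_prodMk_left q (p₁, p₂))).fderiv
  have e2 := (hd.comp (f := fun p' => (q, p', p₂)) p₁ ((hasFDerivAt_prodMk_right q (p₁, p₂)).comp p₁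
    (hasFDerivAt_prodMk_left p₁ p₂))).fderiv
  have e3 := (hd.comp (f := fun p' => (q, p₁, p')) p₂ ((hasFDerivAt_prodMk_right q (p₁, p₂)).comp p₂
    (hasFDerivAt_prodMk_right p₁ p₂))).fderiv
  have s1 : P.gradq q p₁ p₂ ⬝ᵥ vq = _ :=
    (fderiv_eq_grad_dotProduct (fun q' => P.Hd q' p₁ p₂) q vq).symm.trans
      (DFunLike.congr_fun e1 vq)
  have s2 : P.gradp₁ q p₁ p₂ ⬝ᵥ v₁ = _ :=
    (fderiv_eq_grad_dotProduct (fun p' => P.Hd q p' p₂) p₁ v₁).symm.trans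
      (DFunLike.congr_fun e2 v₁)
  have s3 : P.gradp₂ q p₁ p₂ ⬝ᵥ v₂ = _ :=
    (fderiv_eq_grad_dotProduct (fun p' => P.Hd q p₁ p') p₂ v₂).symm.trans
      (DFunLike.congr_fun e3 v₂)
  rw [s1, s2, s3]
  simp only [ContinuousLinearMap.comp_apply, ContinuousLinearMap.inl_apply,
    ContinuousLinearMap.inr_apply]
  rw [← map_add, ← map_add]
  simp

theorem grads_eq_zero_of_isStrictMin {qs : Idx m s → ℝ} (hmin : IsStrictMin P.Vd qs) :
    P.gradq qs 0 0 = 0 ∧ P.gradp₁ qs 0 0 = 0 ∧ P.gradp₂ qs 0 0 = 0 := by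
  refine ⟨?_, ?_, ?_⟩
  · have h : IsLocalMin (fun q => P.Hd q 0 0) qs := by
      simp only [Hd_zero]
      filter_upwards [eventually_nhdsWithin_iff.1 hmin] with q hq
      rcases eq_or_ne q qs with rfl | h
      · exact le_rfl
      · exact (hq h).le
    ext i
    simp only [gradq, grad, h.fderiv_eq_zero]
    simp
  · have h : IsLocalMin (fun p => P.Hd qs p 0) 0 := by
      refine Eventually.of_forall fun p => ?_
      simp only [Hd_zero]
      exact P.Vd_le_Hd _ _ _
    ext i
    simp only [gradp₁, grad, h.fderiv_eq_zero]
    simp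
  · have h : IsLocalMin (fun p => P.Hd qs 0 p) 0 := by
      refine Eventually.of_forall fun p => ?_
      simp only [Hd_zero]
      exact P.Vd_le_Hd _ _ _
    ext i
    simp only [gradp₂, grad, h.fderiv_eq_zero]
    simp

end MechSystem

end IntegralAction

namespace IntegralAction

/-! ### The closed loop and its Lyapunov function. -/

variable {m s : ℕ}

theorem Gains.transpose_KI (K : Gains m) : K.KIᵀ = K.KI := transpose_of_posDef K.KI_posDef

theorem Gains.gradHc_eq (K : Gains m) (p₁ ζ : Fin m → ℝ) : K.gradHc p₁ ζ = K.KI *ᵥ (p₁ - ζ) := by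
  ext i
  have h := fderiv_comp_sub (𝕜 := ℝ) (f := fun y => 1 / 2 * (y ⬝ᵥ K.KI *ᵥ y)) (x := p₁) ζ
  simp only [gradHc, grad, Hc, h]
  rw [fderiv_quadratic K.transpose_KI, dotProduct_single, mul_one]

theorem Gains.dotProduct_Jc₁_sub_Rc₁ (K : Gains m) (v : Fin m → ℝ) :
    v ⬝ᵥ (K.Jc₁ - K.Rc₁) *ᵥ v = -(v ⬝ᵥ K.Rc₁ *ᵥ v) := by
  rw [Matrix.sub_mulVec, dotProduct_sub, dotProduct_mulVec_self_of_skew K.Jc₁_skew, zero_sub]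

/-- A kernel vector v satisfies vᵀR_{c₁}v = 0, since the skew part contributes nothing. -/
theorem Gains.isUnit_Jc₁_sub_Rc₁ (K : Gains m) : IsUnit (K.Jc₁ - K.Rc₁) := by
  rw [← Matrix.mulVec_injective_iff_isUnit]
  refine (injective_iff_map_eq_zero (K.Jc₁ - K.Rc₁).mulVecLin).2 fun v hv => ?_
  have h := K.dotProduct_Jc₁_sub_Rc₁ v
  rw [Matrix.mulVecLin_apply] at hv
  rw [hv, dotProduct_zero] at h
  exact eq_zero_of_dotProduct_mulVec_nonpos K.Rc₁_posDef (by linarith)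

theorem Gains.Jc₁_sub_Rc₁_mulVec_inv (K : Gains m) (v : Fin m → ℝ) :
    (K.Jc₁ - K.Rc₁) *ᵥ (K.Jc₁ - K.Rc₁)⁻¹ *ᵥ v = v := by
  rw [Matrix.mulVec_mulVec, Matrix.mul_nonsing_inv _
    ((Matrix.isUnit_iff_isUnit_det _).1 K.isUnit_Jc₁_sub_Rc₁), Matrix.one_mulVec]

theorem Gains.KI_mulVec_inv (K : Gains m) (v : Fin m → ℝ) : K.KI *ᵥ K.KI⁻¹ *ᵥ v = v := by
  rw [Matrix.mulVec_mulVec, Matrix.mul_nonsing_inv _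
    ((Matrix.isUnit_iff_isUnit_det _).1 K.KI_posDef.isUnit), Matrix.one_mulVec]

/-- The second component of the output. -/
noncomputable def outputError (K : Gains m) (d p₁ ζ : Fin m → ℝ) : Fin m → ℝ :=
  K.KI *ᵥ (p₁ - ζ) - (K.Jc₁ - K.Rc₁)⁻¹ *ᵥ d

variable (P : MechSystem m s) (K : Gains m) (d : Fin m → ℝ)

theorem output_apply (q : Idx m s → ℝ) (p₁ : Fin m → ℝ) (p₂ : Fin s → ℝ) (ζ : Fin m → ℝ) :
    output P K d (q, p₁, p₂, ζ) = (P.gradp₁ q p₁ p₂, outputError K d p₁ ζ) := by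
  simp only [output, outputError, K.gradHc_eq]

/-- The closed loop, with the terms that the controller cancels removed. -/
theorem closedLoop_apply (q : Idx m s → ℝ) (p₁ : Fin m → ℝ) (p₂ : Fin s → ℝ) (ζ : Fin m → ℝ) :
    closedLoop P K d (q, p₁, p₂, ζ) =
      (P.S₁ q *ᵥ P.gradp₁ q p₁ p₂ + P.S₂ q *ᵥ P.gradp₂ q p₁ p₂,
        controllerField P K q p₁ p₂
          + (K.Jc₁ - K.Rc₁) *ᵥ (P.gradp₁ q p₁ p₂ + outputError K d p₁ ζ),
        -((P.S₂ q)ᵀ *ᵥ P.gradq q p₁ p₂) - (P.S₃₂ q p₁ p₂)ᵀ *ᵥ P.gradp₁ q p₁ p₂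
          + P.S₃₄ q p₁ p₂ *ᵥ P.gradp₂ q p₁ p₂,
        controllerField P K q p₁ p₂) := by
  simp only [closedLoop, MechSystem.plant, Prod.mk.injEq, true_and, and_true]
  -- Here the offset in `outputError` is turned back into the disturbance d.
  rw [Matrix.mulVec_add, outputError, Matrix.mulVec_sub _ (K.KI *ᵥ _), K.Jc₁_sub_Rc₁_mulVec_inv]
  simp only [control, controllerField, K.gradHc_eq, Matrix.sub_mulVec, Matrix.add_mulVec,
    Matrix.neg_mulVec]
  abel

/-- The gradients of H_d and the Jacobian of T⁻¹p each cost one derivative, whence the `C²` data. -/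
theorem contDiff_closedLoop : ContDiff ℝ 1 (closedLoop P K d) := by
  have hq : ContDiff ℝ 1 fun x : State m s => x.1 := contDiff_fst
  have h₁ : ContDiff ℝ 1 fun x : State m s => x.2.1 := contDiff_snd.fst
  have h₂ : ContDiff ℝ 1 fun x : State m s => x.2.2.1 := contDiff_snd.snd.fst
  have h₃ : ContDiff ℝ 1 fun x : State m s => x.2.2.2 := contDiff_snd.snd.snd
  have hgq := P.contDiff_gradq hq h₁ h₂
  have hg₁ := P.contDiff_gradp₁ hq h₁ h₂
  have hg₂ := P.contDiff_gradp₂ hq h₁ h₂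
  have hS₁ := P.contDiff_S₁ hq
  have hS₂ := P.contDiff_S₂ hq
  have hS₃₂ := P.contDiff_S₃₂ hq h₁ h₂
  have hc {κ : Type} [Fintype κ] (A : Matrix (Fin m) κ ℝ) :
      ∀ i j, ContDiff ℝ 1 fun _ : State m s => A i j := fun _ _ => contDiff_const
  have he : ContDiff ℝ 1 fun x : State m s => outputError K d x.2.1 x.2.2.2 :=
    (contDiff_mulVec (hc K.KI) (h₁.sub h₃)).sub contDiff_const
  have hu : ContDiff ℝ 1 fun x : State m s => controllerField P K x.1 x.2.1 x.2.2.1 :=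
    (((contDiff_mulVec (hc K.Rc₂) hg₁).neg).sub
      (contDiff_mulVec (fun i j => hS₁ j i) hgq)).add (contDiff_mulVec hS₃₂ hg₂)
  rw [show closedLoop P K d = _ from funext fun x => closedLoop_apply P K d x.1 x.2.1 x.2.2.1 x.2.2.2]
  exact ((contDiff_mulVec hS₁ hg₁).add (contDiff_mulVec hS₂ hg₂)).prodMk
    ((hu.add (contDiff_mulVec (hc _) (hg₁.add he))).prodMk
    ((((contDiff_mulVec (fun i j => hS₂ j i) hgq).neg.sub
      (contDiff_mulVec (fun i j => hS₃₂ j i) hg₁)).add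
      (contDiff_mulVec (P.contDiff_S₃₄ hq h₁ h₂) hg₂)).prodMk hu))

theorem differentiable_lyapunov : Differentiable ℝ (lyapunov P K d) := by
  have he : ContDiff ℝ 2 fun x : State m s =>
      (x.2.1 - x.2.2.2) - K.KI⁻¹ *ᵥ (K.Jc₁ - K.Rc₁)⁻¹ *ᵥ d :=
    (contDiff_snd.fst.sub contDiff_snd.snd.snd).sub contDiff_const
  have hH : ContDiff ℝ 2 fun x : State m s => P.Hd x.1 x.2.1 x.2.2.1 :=
    P.contDiff_Hd contDiff_fst contDiff_snd.fst contDiff_snd.snd.fst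
  have hQ := contDiff_dotProduct he (contDiff_mulVec (A := fun _ => K.KI)
    (fun _ _ => contDiff_const) he)
  exact (hH.add ((contDiff_const (c := (1 / 2 : ℝ))).mul hQ)).differentiable two_ne_zero

theorem fderiv_lyapunov (q vq : Idx m s → ℝ) (p₁ v₁ : Fin m → ℝ) (p₂ v₂ : Fin s → ℝ)
    (ζ vζ : Fin m → ℝ) :
    fderiv ℝ (lyapunov P K d) (q, p₁, p₂, ζ) (vq, v₁, v₂, vζ)
      = P.gradq q p₁ p₂ ⬝ᵥ vq + P.gradp₁ q p₁ p₂ ⬝ᵥ v₁ + P.gradp₂ q p₁ p₂ ⬝ᵥ v₂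
        + outputError K d p₁ ζ ⬝ᵥ (v₁ - vζ) := by
  let π : State m s →L[ℝ] (Idx m s → ℝ) × (Fin m → ℝ) × (Fin s → ℝ) :=
    (ContinuousLinearMap.fst ℝ _ _).prod
      (((ContinuousLinearMap.fst ℝ _ _).comp (ContinuousLinearMap.snd ℝ _ _)).prod
        ((ContinuousLinearMap.fst ℝ _ _).comp
          ((ContinuousLinearMap.snd ℝ _ _).comp (ContinuousLinearMap.snd ℝ _ _))))
  let ρ : State m s →L[ℝ] (Fin m → ℝ) :=
    ((ContinuousLinearMap.fst ℝ _ _).comp (ContinuousLinearMap.snd ℝ _ _)) -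
      ((ContinuousLinearMap.snd ℝ _ _).comp
        ((ContinuousLinearMap.snd ℝ _ _).comp (ContinuousLinearMap.snd ℝ _ _)))
  set z := K.KI⁻¹ *ᵥ (K.Jc₁ - K.Rc₁)⁻¹ *ᵥ d with hz
  have hQ : ContDiff ℝ 1 fun y : Fin m → ℝ => 1 / 2 * (y ⬝ᵥ K.KI *ᵥ y) :=
    contDiff_const.mul (contDiff_dotProduct contDiff_id
      (contDiff_mulVec (fun _ _ => contDiff_const) contDiff_id))
  have h1 := ((P.contDiff_Hd_uncurried.differentiable two_ne_zero
    (π (q, p₁, p₂, ζ))).hasFDerivAt.comp (q, p₁, p₂, ζ) π.hasFDerivAt)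
  have h2 := ((hQ.differentiable one_ne_zero
    (ρ (q, p₁, p₂, ζ) - z)).hasFDerivAt.comp (f := fun x => ρ x - z) (q, p₁, p₂, ζ)
      (ρ.hasFDerivAt.sub_const z))
  have h : HasFDerivAt (lyapunov P K d) _ (q, p₁, p₂, ζ) := h1.add h2
  rw [h.fderiv]
  simp only [add_apply, ContinuousLinearMap.comp_apply]
  rw [fderiv_quadratic K.transpose_KI, Matrix.mulVec_sub, hz, K.KI_mulVec_inv]
  exact congrArg₂ (· + ·) (P.fderiv_Hd q vq p₁ v₁ p₂ v₂) rfl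

/-- The dissipation identity of the closed loop. -/
theorem fderiv_lyapunov_closedLoop (q : Idx m s → ℝ) (p₁ : Fin m → ℝ) (p₂ : Fin s → ℝ)
    (ζ : Fin m → ℝ) :
    fderiv ℝ (lyapunov P K d) (q, p₁, p₂, ζ) (closedLoop P K d (q, p₁, p₂, ζ))
      = -(P.gradp₁ q p₁ p₂ ⬝ᵥ K.Rc₂ *ᵥ P.gradp₁ q p₁ p₂)
        - (P.gradp₁ q p₁ p₂ + outputError K d p₁ ζ) ⬝ᵥ
            K.Rc₁ *ᵥ (P.gradp₁ q p₁ p₂ + outputError K d p₁ ζ) := by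
  rw [closedLoop_apply, fderiv_lyapunov, add_sub_cancel_left, controllerField]
  have hA := K.dotProduct_Jc₁_sub_Rc₁ (P.gradp₁ q p₁ p₂ + outputError K d p₁ ζ)
  have hJ := dotProduct_mulVec_self_of_skew (P.S₃₄_skew q p₁ p₂) (P.gradp₂ q p₁ p₂)
  rw [add_dotProduct] at hA
  have e1 := dotProduct_mulVec_comm (P.S₁ q) (P.gradq q p₁ p₂) (P.gradp₁ q p₁ p₂)
  have e2 := dotProduct_mulVec_comm (P.S₂ q) (P.gradq q p₁ p₂) (P.gradp₂ q p₁ p₂)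
  have e3 := dotProduct_mulVec_comm (P.S₃₂ q p₁ p₂) (P.gradp₁ q p₁ p₂) (P.gradp₂ q p₁ p₂)
  simp only [dotProduct_add (P.gradq q p₁ p₂), dotProduct_add (P.gradp₂ q p₁ p₂),
    dotProduct_add (P.gradp₁ q p₁ p₂) (_ + _), dotProduct_add (P.gradp₁ q p₁ p₂) (_ - _),
    dotProduct_sub, dotProduct_neg]
  -- `hA` leaves only the R_{c₁} dissipation, `hJ` removes S₃₄, and `e1`, `e2`, `e3` cancel the
  -- power exchanged through S₁, S₂ and S₃₂.
  linear_combination hA + hJ + e1 + e2 + e3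

theorem fderiv_lyapunov_closedLoop_nonpos (x : State m s) :
    fderiv ℝ (lyapunov P K d) x (closedLoop P K d x) ≤ 0 := by
  obtain ⟨q, p₁, p₂, ζ⟩ := x
  have h1 := dotProduct_mulVec_nonneg K.Rc₂_posDef (P.gradp₁ q p₁ p₂)
  have h2 := dotProduct_mulVec_nonneg K.Rc₁_posDef (P.gradp₁ q p₁ p₂ + outputError K d p₁ ζ)
  rw [fderiv_lyapunov_closedLoop]
  linarith

theorem output_eq_zero_of_fderiv_lyapunov_eq_zero (x : State m s)
    (h : fderiv ℝ (lyapunov P K d) x (closedLoop P K d x) = 0) : output P K d x = 0 := by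
  obtain ⟨q, p₁, p₂, ζ⟩ := x
  have h1 := dotProduct_mulVec_nonneg K.Rc₂_posDef (P.gradp₁ q p₁ p₂)
  have h2 := dotProduct_mulVec_nonneg K.Rc₁_posDef (P.gradp₁ q p₁ p₂ + outputError K d p₁ ζ)
  rw [fderiv_lyapunov_closedLoop] at h
  have ha := eq_zero_of_dotProduct_mulVec_nonpos K.Rc₂_posDef (v := P.gradp₁ q p₁ p₂) (by linarith)
  have he := eq_zero_of_dotProduct_mulVec_nonpos K.Rc₁_posDef
    (v := P.gradp₁ q p₁ p₂ + outputError K d p₁ ζ) (by linarith)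
  rw [ha, zero_add] at he
  rw [output_apply, ha, he]
  rfl

theorem closedLoop_equilibrium {qs : Idx m s → ℝ} (hmin : IsStrictMin P.Vd qs) :
    closedLoop P K d (equilibrium K qs d) = 0 := by
  obtain ⟨h1, h2, h3⟩ := P.grads_eq_zero_of_isStrictMin hmin
  rw [equilibrium, closedLoop_apply]
  have he : outputError K d 0 (-(K.KI⁻¹ *ᵥ (K.Jc₁ - K.Rc₁)⁻¹ *ᵥ d)) = 0 := by
    rw [outputError, zero_sub, neg_neg, K.KI_mulVec_inv, sub_self]
  simp [controllerField, h1, h2, h3, he, -Matrix.mulVec_mulVec]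

theorem isStrictMin_lyapunov {qs : Idx m s → ℝ} (hmin : IsStrictMin P.Vd qs) :
    IsStrictMin (lyapunov P K d) (equilibrium K qs d) := by
  have h := (continuous_fst.tendsto (equilibrium K qs d : State m s)).eventually
    (eventually_nhdsWithin_iff.1 hmin)
  refine eventually_nhdsWithin_iff.2 ?_
  -- Only q has to be near its equilibrium value: the two quadratic forms are definite everywhere.
  filter_upwards [h] with x hx hne
  obtain ⟨q, p₁, p₂, ζ⟩ := x
  simp only [lyapunov, equilibrium, P.Hd_zero, zero_sub, neg_neg, sub_self, zero_dotProduct,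
    mul_zero, add_zero]
  have he := dotProduct_mulVec_nonneg K.KI_posDef
    (p₁ - ζ - K.KI⁻¹ *ᵥ (K.Jc₁ - K.Rc₁)⁻¹ *ᵥ d)
  have hH := P.Vd_le_Hd q p₁ p₂
  by_cases hq : q = qs
  · subst hq
    by_cases hp : p₁ ≠ 0 ∨ p₂ ≠ 0
    · linarith [P.Vd_lt_Hd q hp]
    · push Not at hp
      obtain ⟨rfl, rfl⟩ := hp
      have := dotProduct_mulVec_pos K.KI_posDef
        (v := 0 - ζ - K.KI⁻¹ *ᵥ (K.Jc₁ - K.Rc₁)⁻¹ *ᵥ d) (fun h0 => hne (by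
          have : ζ = -(K.KI⁻¹ *ᵥ (K.Jc₁ - K.Rc₁)⁻¹ *ᵥ d) := by
            rw [zero_sub] at h0
            rw [← sub_eq_zero.1 h0, neg_neg]
          simp [equilibrium, this]))
      linarith
  · have : P.Vd qs < P.Vd q := hx hq
    linarith

theorem isLyapunovFunction_lyapunov {qs : Idx m s → ℝ} (hmin : IsStrictMin P.Vd qs) :
    IsLyapunovFunction (closedLoop P K d) (lyapunov P K d) (equilibrium K qs d) :=
  ⟨differentiable_lyapunov P K d, isStrictMin_lyapunov P K d hmin,
    fderiv_lyapunov_closedLoop_nonpos P K d⟩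

/-- The crude inequality 2|a| ≤ a² + 1 avoids square roots. -/
theorem norm_le_of_sq_apply_le {ι : Type*} [Fintype ι] {v : ι → ℝ} {C : ℝ} (hC : 0 ≤ C)
    (h : ∀ i, v i ^ 2 ≤ C) : ‖v‖ ≤ C + 1 := by
  refine (pi_norm_le_iff_of_nonneg (by linarith)).2 fun i => ?_
  rw [Real.norm_eq_abs, abs_le]
  constructor <;> nlinarith [h i, sq_nonneg (v i - 1), sq_nonneg (v i + 1)]

/-- Properness confines q to a compact set, on which the trace of the shaped mass matrix is bounded;
`sq_apply_le_trace_mul` then bounds p uniformly in q, and likewise p₁ - ζ. -/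
theorem isBounded_sublevel_lyapunov (hV : Tendsto P.Vd (cocompact (Idx m s → ℝ)) atTop) (c : ℝ) :
    Bornology.IsBounded {x | lyapunov P K d x ≤ c} := by
  have hcont : Continuous P.Vd := P.Vd_smooth.continuous
  obtain ⟨q₀, hq₀⟩ := hcont.exists_forall_le hV
  set b := P.Vd q₀
  obtain ⟨Q, hQ, hVQ⟩ := mem_cocompact.1 (hV.eventually (eventually_gt_atTop c))
  have hQmem : ∀ q, P.Vd q ≤ c → q ∈ Q := fun q hq => by
    by_contra h
    exact (hVQ h).not_ge hq
  have htr : Continuous fun q => (P.MdT q).trace :=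
    continuous_finsetSum _ fun i _ => (P.MdT_smooth i i).continuous
  obtain ⟨B, hB⟩ := (hQ.image htr).bddAbove
  obtain ⟨D, hD⟩ := hQ.isBounded.exists_norm_le
  set z := K.KI⁻¹ *ᵥ (K.Jc₁ - K.Rc₁)⁻¹ *ᵥ d with hz
  -- As V_d ≥ b, each quadratic form is at most 2(c - b) on the sublevel set. The maximum with 0
  -- keeps the bounds nonnegative also when c < b.
  set c' := max (2 * (c - b)) 0
  set B₁ := max B 0 * c'
  set B₂ := max (K.KI⁻¹).trace 0 * c'
  have hB₁ : 0 ≤ B₁ := mul_nonneg (le_max_right _ _) (le_max_right _ _)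
  have hB₂ : 0 ≤ B₂ := mul_nonneg (le_max_right _ _) (le_max_right _ _)
  have hdetK := (Matrix.isUnit_iff_isUnit_det _).1 K.KI_posDef.isUnit
  refine isBounded_iff_forall_norm_le.2 ⟨max D (B₁ + 1 + (B₂ + 1) + ‖z‖), ?_⟩
  rintro ⟨q, p₁, p₂, ζ⟩ hx
  have hp := dotProduct_mulVec_nonneg (P.MdT_posDef q).inv (Sum.elim p₁ p₂)
  have he := dotProduct_mulVec_nonneg K.KI_posDef (p₁ - ζ - z)
  have hx' : 1 / 2 * (Sum.elim p₁ p₂ ⬝ᵥ (P.MdT q)⁻¹ *ᵥ Sum.elim p₁ p₂) + P.Vd q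
      + 1 / 2 * ((p₁ - ζ - z) ⬝ᵥ K.KI *ᵥ (p₁ - ζ - z)) ≤ c := hx
  have hb := hq₀ q
  have hqQ := hQmem q (by linarith)
  have hpn : ‖(Sum.elim p₁ p₂ : Idx m s → ℝ)‖ ≤ B₁ + 1 := by
    refine norm_le_of_sq_apply_le hB₁ fun i =>
      (sq_apply_le_trace_mul (P.MdT_posDef q) _ i).trans ?_
    exact mul_le_mul ((hB ⟨q, hqQ, rfl⟩).trans (le_max_left _ _))
      (le_max_of_le_left (by linarith)) hp (le_max_right _ _)
  have hen : ‖p₁ - ζ - z‖ ≤ B₂ + 1 := by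
    refine norm_le_of_sq_apply_le hB₂ fun i =>
      (sq_apply_le_trace_mul K.KI_posDef.inv _ i).trans ?_
    -- The trace estimate is used for K_I⁻¹, whose inverse is the matrix of the form in W.
    rw [Matrix.nonsing_inv_nonsing_inv _ hdetK]
    exact mul_le_mul (le_max_left _ _) (le_max_of_le_left (by linarith)) he (le_max_right _ _)
  rw [pi_norm_le_iff_of_nonneg (by linarith)] at hpn
  have hp₁ : ‖p₁‖ ≤ B₁ + 1 :=
    (pi_norm_le_iff_of_nonneg (by linarith)).2 fun i => hpn (Sum.inl i)
  have hp₂ : ‖p₂‖ ≤ B₁ + 1 :=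
    (pi_norm_le_iff_of_nonneg (by linarith)).2 fun i => hpn (Sum.inr i)
  have hζ : ‖ζ‖ ≤ B₁ + 1 + (B₂ + 1) + ‖z‖ := by
    calc ‖ζ‖ = ‖p₁ - (p₁ - ζ - z) - z‖ := by congr 1; abel
      _ ≤ ‖p₁‖ + ‖p₁ - ζ - z‖ + ‖z‖ :=
        (norm_sub_le _ _).trans (add_le_add_left (norm_sub_le _ _) _)
      _ ≤ _ := by gcongr
  have hz0 := norm_nonneg z
  refine norm_prod_le_iff.2 ⟨le_max_of_le_left (hD q hqQ), norm_prod_le_iff.2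
    ⟨le_max_of_le_right (hp₁.trans ?_), norm_prod_le_iff.2
      ⟨le_max_of_le_right (hp₂.trans ?_), le_max_of_le_right hζ⟩⟩⟩ <;> linarith

end IntegralAction

theorem mainTheorem1 {m s : ℕ} (P : IntegralAction.MechSystem m s) (K : IntegralAction.Gains m)
    (qs : IntegralAction.Idx m s → ℝ)
    (hmin : IntegralAction.IsStrictMin
      (fun x : (IntegralAction.Idx m s → ℝ) × (IntegralAction.Idx m s → ℝ) => P.Hbold x.1 x.2)
      (qs, 0))
    (d : Fin m → ℝ) :
    -- the equilibrium is stable, with Lyapunov function `W`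
    (IntegralAction.closedLoop P K d (IntegralAction.equilibrium K qs d) = 0 ∧
      IntegralAction.IsLyapunovFunction (IntegralAction.closedLoop P K d)
        (IntegralAction.lyapunov P K d) (IntegralAction.equilibrium K qs d) ∧
      IntegralAction.IsStable (IntegralAction.closedLoop P K d)
        (IntegralAction.equilibrium K qs d)) ∧
    -- (local) detectability gives asymptotic stability
    ((∃ U ∈ 𝓝 (IntegralAction.equilibrium K qs d : IntegralAction.State m s),
        IntegralAction.IsDetectableOn (IntegralAction.closedLoop P K d)
          (IntegralAction.output P K d) (IntegralAction.equilibrium K qs d) U) →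
      IntegralAction.IsAsymptoticallyStable (IntegralAction.closedLoop P K d)
        (IntegralAction.equilibrium K qs d)) ∧
    -- for radially unbounded potential energy both properties are global
    (Tendsto P.Vd (cocompact (IntegralAction.Idx m s → ℝ)) atTop →
      IntegralAction.IsGloballyStable (IntegralAction.closedLoop P K d)
        (IntegralAction.equilibrium K qs d) ∧
      (IntegralAction.IsDetectableOn (IntegralAction.closedLoop P K d)
          (IntegralAction.output P K d) (IntegralAction.equilibrium K qs d) univ →
        IntegralAction.IsGloballyAsymptoticallyStable (IntegralAction.closedLoop P K d)
          (IntegralAction.equilibrium K qs d))) := by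
  have hV := P.isStrictMin_Vd hmin
  have hf := IntegralAction.contDiff_closedLoop P K d
  have hW := IntegralAction.isLyapunovFunction_lyapunov P K d hV
  have hout := IntegralAction.output_eq_zero_of_fderiv_lyapunov_eq_zero P K d
  refine ⟨⟨IntegralAction.closedLoop_equilibrium P K d hV, hW,
    IntegralAction.isStable_of_isLyapunovFunction hf hW⟩, ?_, fun hrad => ?_⟩
  · rintro ⟨U, hU, hdet⟩
    exact IntegralAction.isAsymptoticallyStable_of_isDetectableOn hf hW hout hU hdet
  · have hbdd := IntegralAction.isBounded_sublevel_lyapunov P K d hrad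
    exact ⟨IntegralAction.isGloballyStable_of_isBounded_sublevel hf hW hbdd,
      IntegralAction.isGloballyAsymptoticallyStable_of_isDetectableOn hf hW hout hbdd⟩
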